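/- Fix positive integers $a,b$. Write $I_a=12\cdots a$ and $J_b=b\cdots 21$; a permutation contains $I_a$ (resp. $J_b$) if it has an increasing subsequence of length $a$ (resp. a decreasing subsequence of length $b$). In the $(a,b)$-game two players alternately append a digit to a permutation, player 1 moving first and starting from the empty permutation: if the current position is a permutation $\pi$ of $\{1,\dots,n\}$, the player to move chooses $m\in\{1,\dots,n+1\}$, every digit of $\pi$ that is at least $m$ is raised by $1$, and $m$ is appended at the end. The game ends as soon as the permutation contains $I_a$ or $J_b$. The player who made the last move wins in the *achievement* version and loses in the *avoidance* version. A strategy assigns a move to every position. The *board game* with $C$ columns and $R$ rows is played on the cells $(c,r)$, $1\le c\le C$, $1\le r\le R$. Player 1 begins by shading $(1,1)$; then the players alternately choose an unshaded cell $(c,r)$ that shares an edge with a shaded cell, and all cells $(c',r')$ with $c'\le c$, $r'\le r$ become shaded. The player who fills the board, that is, who claims the corner $(C,R)$, wins; if the board has no cells, player 2 wins. (1) Reduction. Let $a,b\ge 2$ and let $p$ be either player. Every winning strategy of $p$ for the achievement $(a,b)$-game is a winning strategy of $p$ for the avoidance $(a-1,b-1)$-game. Conversely, for every winning strategy $\sigma$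 of $p$ for the avoidance $(a-1,b-1)$-game there is a winning strategy of $p$ for the achievement $(a,b)$-game that agrees with $\sigma$ on all positions containing neither $I_{a-1}$ nor $J_{b-1}$. Hence $p$ has a winning strategy for the achievement $(a,b)$-game if and only if $p$ has one for the avoidance $(a-1,b-1)$-game, and also if and only if $p$ has one for the board game with $a-2$ columns and $b-2$ rows. (2) If $a\ge b$ and $4\le b\le 6$, player 1 has a winning strategy for the achievement $(a,b)$-game. (3) If $a\ge 3$, then in the achievement $(a,3)$-game player 1 has a winning strategy if and only if $a$ is odd, and player 2 has a winning strategy if and only if $a$ is even. (4) If $a\ge 2$, player 2 has a winning strategy for the achievement $(a,2)$-game; indeed every strategy of player 2 that answers the position $1$ by appending the digit $1$ (producing $21$) is winning. -/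

import Mathlib

namespace ErdosSzekeres

/-- The two players of an alternating game; the first player makes the first move. -/
inductive Player where
  | first
  | second

/-- The opponent of a player. -/
def Player.other : Player → Player
  | .first => .second
  | .second => .first

/-- A two-player game of perfect information with positions `P` and moves `M`. -/
structure TurnGame (P M : Type) where
  /-- the initial position -/
  start : P
  /-- the player whose turn it is -/
  toMove : P → Player
  /-- the legal moves in a position -/
  Legal : P → M → Prop
  /-- the position after a move -/
  next : P → M → P
  /-- the game has ended in this position -/
  Over : P → Prop
  /-- the winner in a position in which the game has ended -/
  winner : P → Player

/-- `WinsFrom G p σ x`: every play of `G` that starts in the position `x` and in which player `p`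
always plays the move prescribed by `σ` ends after finitely many moves with a win for `p`
(and `σ` prescribes a legal move whenever `p` has to move in such a play). -/
inductive WinsFrom {P M : Type} (G : TurnGame P M) (p : Player) (σ : P → M) : P → Prop
  | ended (x : P) (h : G.Over x) (hw : G.winner x = p) : WinsFrom G p σ x
  | own (x : P) (h : ¬ G.Over x) (ht : G.toMove x = p) (hl : G.Legal x (σ x))
      (hn : WinsFrom G p σ (G.next x (σ x))) : WinsFrom G p σ x
  | opp (x : P) (h : ¬ G.Over x) (ht : G.toMove x ≠ p)
      (hn : ∀ m : M, G.Legal x m → WinsFrom G p σ (G.next x m)) : WinsFrom G p σ x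

/-- `σ` is a winning strategy for player `p` in the game `G`. -/
def IsWinningStrategy {P M : Type} (G : TurnGame P M) (p : Player) (σ : P → M) : Prop :=
  WinsFrom G p σ G.start

/-- Player `p` has a winning strategy in the game `G`. -/
def HasWinningStrategy {P M : Type} (G : TurnGame P M) (p : Player) : Prop :=
  ∃ σ : P → M, IsWinningStrategy G p σ

/-- The sequence `π` contains the pattern `I_a = 1 2 ⋯ a`: it has an increasing subsequence of
length `a`. -/
def ContainsI (a : ℕ) (π : List ℕ) : Prop :=
  ∃ s : List ℕ, s.Sublist π ∧ s.length = a ∧ s.Pairwise (· < ·)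

/-- The sequence `π` contains the pattern `J_b = b ⋯ 2 1`: it has a decreasing subsequence of
length `b`. -/
def ContainsJ (b : ℕ) (π : List ℕ) : Prop :=
  ∃ s : List ℕ, s.Sublist π ∧ s.length = b ∧ s.Pairwise (· > ·)

/-- Append the digit `m` to the permutation `π` (in one-line notation): the digits of `π` that are
at least `m` are raised by one, so that their relative order is unchanged. -/
def appendDigit (π : List ℕ) (m : ℕ) : List ℕ :=
  π.map (fun x => if x < m then x else x + 1) ++ [m]

/-- The player whose turn it is after `n` moves. -/
def playerAfter (n : ℕ) : Player :=
  if Even n then .first else .second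

/-- The two versions of the game: completing a forbidden pattern wins (achievement), or loses
(avoidance). -/
inductive Version where
  | achievement
  | avoidance

/-- The `(a, b)`-game. A position is a permutation of `1, …, n` in one-line notation, where `n` is
the number of moves made so far; a move is a digit `m` with `1 ≤ m ≤ n + 1`, which is appended. The
game ends as soon as `I_a` or `J_b` is contained. The player who then has made the last
move wins the achievement version, and the opponent (who would be next to move) wins the avoidance
version. As a position determines all the moves that led to it, a strategy may be taken to be a
function of the position. -/
def esGame (v : Version) (a b : ℕ) : TurnGame (List ℕ) ℕ where
  start := []
  toMove π := playerAfter π.length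
  Legal π m := 1 ≤ m ∧ m ≤ π.length + 1
  next := appendDigit
  Over π := ContainsI a π ∨ ContainsJ b π
  winner π :=
    match v with
    | .achievement => (playerAfter π.length).other
    | .avoidance => playerAfter π.length

/-- The cells `(c, r)` (column `c`, row `r`) of the board with `cols` columns and `rows` rows. -/
def board (cols rows : ℕ) : Finset (ℕ × ℕ) :=
  Finset.Icc 1 cols ×ˢ Finset.Icc 1 rows

/-- Two cells share an edge. -/
def EdgeAdjacent (x y : ℕ × ℕ) : Prop :=
  (x.1 = y.1 ∧ (x.2 + 1 = y.2 ∨ y.2 + 1 = x.2)) ∨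
  (x.2 = y.2 ∧ (x.1 + 1 = y.1 ∨ y.1 + 1 = x.1))

/-- The cell-shading form of the avoidance game, on the board with `cols` columns and `rows` rows.
A position is the set of shaded or eliminated cells with the player to move. The first move shades
`(1, 1)`; every later one shades an open cell that shares an edge with the shaded region. All cells
`(c', r')` with `c' ≤ c` and `r' ≤ r` are shaded along with a chosen cell `(c, r)`. When the board
is full, the player who made the last move has claimed the bottom right corner and wins. (On an
empty board the first player cannot move and loses.) -/
def boardGame (cols rows : ℕ) : TurnGame (Finset (ℕ × ℕ) × Player) (ℕ × ℕ) where
  start := (∅, .first)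
  toMove s := s.2
  Legal s x := x ∈ board cols rows ∧ x ∉ s.1 ∧
    ((s.1 = ∅ ∧ x = (1, 1)) ∨ ∃ y ∈ s.1, EdgeAdjacent y x)
  next s x := (s.1 ∪ board x.1 x.2, s.2.other)
  Over s := board cols rows ⊆ s.1
  winner s := s.2.other

end ErdosSzekeres

/-! Label each entry of a permutation with the pair (c, r) of lengths of the longest increasing and
the longest decreasing subsequence ending there, and shade all cells weakly below some label in both
coordinates. By the Erdős–Szekeres argument (`inc_extends_or_dec_extends`), an appended digit
receives an unshaded label next to the shaded region (`label_adjacent`), and every such cell is the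
label of some digit (`exists_digit_of_adjacent`). Old labels never change. Hence avoiding `I_(A+1)`
and `J_(B+1)` is the shading game on the board with A columns and B rows: a label off the board
completes a pattern and loses, so whoever fills the board wins.

One digit lengthens a longest monotone subsequence by at most one, and a largest or smallest digit
does lengthen it. So in the achievement game whoever first creates `I_(a-1)` or `J_(b-1)` lets the
opponent win at once; both players must avoid these patterns.

On the board it suffices to exhibit a set of regions that the player can restore after every move
and that never offers the opponent the last cell (`exists_winsFrom_of_closed`). With one row all
moves are forced and parity decides. For two to four rows the sets `TwoRows`, `ThreeRows` and
`FourRows` are described by differences of consecutive row lengths, so they serve all widths at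
once; special types handle a full first row, and four rows also need the parity of the number of
missing columns. -/

namespace ErdosSzekeres

/-! ### Monotone subsequences with a prescribed last entry -/

/-- The sequence `π` has an `R`-chain of length `c` as a subsequence whose last entry is `v`. -/
def EndsChain (R : ℕ → ℕ → Prop) (π : List ℕ) (v c : ℕ) : Prop :=
  ∃ s : List ℕ, (s ++ [v]).Sublist π ∧ s.length + 1 = c ∧ (s ++ [v]).Pairwise R

namespace EndsChain

variable {R : ℕ → ℕ → Prop} {π : List ℕ} {v c m : ℕ}

theorem mem (h : EndsChain R π v c) : v ∈ π := by
  obtain ⟨s, hs, -, -⟩ := h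
  exact hs.subset (by simp)

theorem pos (h : EndsChain R π v c) : 1 ≤ c := by
  obtain ⟨s, -, hs, -⟩ := h
  omega

theorem le_length (h : EndsChain R π v c) : c ≤ π.length := by
  obtain ⟨s, hs, hc, -⟩ := h
  simpa [hc] using hs.length_le

theorem one (h : v ∈ π) : EndsChain R π v 1 :=
  ⟨[], by simpa using h, rfl, by simp⟩

theorem pred (h : EndsChain R π v (c + 1)) (hc : 1 ≤ c) : ∃ u, R u v ∧ EndsChain R π u c := by
  obtain ⟨s, hs, hl, hp⟩ := h
  rcases List.eq_nil_or_concat s with rfl | ⟨s', u, rfl⟩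
  · simp at hl; omega
  · rw [List.concat_eq_append] at hs hp hl
    refine ⟨u, ?_, s', ?_, ?_, ?_⟩
    · simp only [List.pairwise_append] at hp
      exact hp.2.2 u (by simp) v (by simp)
    · exact (List.sublist_append_left _ _).trans hs
    · simpa using hl
    · exact (List.pairwise_append.1 hp).1

theorem of_succ (h : EndsChain R π v (c + 1)) (hc : 1 ≤ c) : EndsChain R π v c := by
  obtain ⟨s, hs, hl, hp⟩ := h
  cases s with
  | nil => simp at hl; omega
  | cons x s =>
    refine ⟨s, (List.sublist_cons_self _ _).trans hs, by simpa using hl, ?_⟩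
    exact hp.sublist (List.sublist_cons_self _ _)

theorem of_le {c' : ℕ} (h : EndsChain R π v c) (hc : 1 ≤ c') (hcc : c' ≤ c) :
    EndsChain R π v c' := by
  induction c, hcc using Nat.le_induction with
  | base => exact h
  | succ n hn ih => exact ih (h.of_succ (hc.trans hn))

theorem append_right (h : EndsChain R π v c) (l : List ℕ) : EndsChain R (π ++ l) v c := by
  obtain ⟨s, hs, hl, hp⟩ := h
  exact ⟨s, hs.trans (List.sublist_append_left _ _), hl, hp⟩

theorem append_singleton_of_ne (hv : v ≠ m) (h : EndsChain R (π ++ [m]) v c) :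
    EndsChain R π v c := by
  obtain ⟨s, hs, hl, hp⟩ := h
  refine ⟨s, ?_, hl, hp⟩
  obtain ⟨l₁, l₂, he, h₁, h₂⟩ := List.sublist_append_iff.1 hs
  rcases List.eq_nil_or_concat l₂ with rfl | ⟨l', x, rfl⟩
  · simpa [he] using h₁
  · rw [List.concat_eq_append, ← List.append_assoc] at he
    have hx : v = x := by simpa using (List.append_inj' he rfl).2
    have : x ∈ [m] := h₂.subset (by simp)
    simp at this
    omega

theorem append_singleton_self_iff [IsTrans ℕ R] (hm : m ∉ π) :
    EndsChain R (π ++ [m]) m (c + 1) ↔ c = 0 ∨ ∃ u, R u m ∧ EndsChain R π u c := by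
  constructor
  · intro h
    rcases Nat.eq_zero_or_pos c with rfl | hc
    · exact Or.inl rfl
    obtain ⟨s, hs, hl, hp⟩ := h
    rcases List.eq_nil_or_concat s with rfl | ⟨s', u, rfl⟩
    · simp at hl; omega
    · refine Or.inr ⟨u, ?_, s', ?_, ?_, ?_⟩
      · simp only [List.pairwise_append] at hp
        exact hp.2.2 u (by simp) m (by simp)
      · rw [List.concat_eq_append] at hs
        exact (List.append_sublist_append_right _).1 hs
      · simpa using hl
      · simpa using (List.pairwise_append.1 hp).1
  · rintro (rfl | ⟨u, hu, s, hs, hl, hp⟩)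
    · exact one (by simp)
    · refine ⟨s ++ [u], hs.append (List.Sublist.refl _), by simpa using hl, ?_⟩
      rw [List.pairwise_append]
      refine ⟨hp, by simp, ?_⟩
      intro x hx y hy
      obtain rfl : y = m := by simpa using hy
      rcases List.mem_append.1 hx with hx | hx
      · exact _root_.trans ((List.pairwise_append.1 hp).2.2 x hx u (by simp)) hu
      · obtain rfl : x = u := by simpa using hx
        exact hu

theorem map_iff {f : ℕ → ℕ} (hf : Function.Injective f) (hR : ∀ x y, R (f x) (f y) ↔ R x y) :
    EndsChain R (π.map f) (f v) c ↔ EndsChain R π v c := by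
  constructor
  · rintro ⟨s, hs, hl, hp⟩
    obtain ⟨t, ht, he⟩ := List.sublist_map_iff.1 hs
    rcases List.eq_nil_or_concat t with rfl | ⟨t', u, rfl⟩
    · simp at he
    · rw [List.concat_eq_append] at he ht
      rw [List.map_append] at he
      obtain ⟨h₁, h₂⟩ := List.append_inj' he rfl
      obtain rfl : v = u := hf (by simpa using h₂)
      subst h₁
      refine ⟨t', ht, by simpa using hl, ?_⟩
      rw [he, ← List.map_append, List.pairwise_map] at hp
      simpa only [hR] using hp
  · rintro ⟨s, hs, hl, hp⟩
    refine ⟨s.map f, by simpa using hs.map f, by simpa using hl, ?_⟩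
    have := List.pairwise_map.2 (hp.imp fun {x y} h => (hR x y).2 h)
    simpa using this

end EndsChain

theorem exists_endsChain_iff {R : ℕ → ℕ → Prop} {π : List ℕ} {k : ℕ} :
    (∃ s : List ℕ, s.Sublist π ∧ s.length = k + 1 ∧ s.Pairwise R) ↔
      ∃ v, EndsChain R π v (k + 1) := by
  constructor
  · rintro ⟨s, hs, hl, hp⟩
    rcases List.eq_nil_or_concat s with rfl | ⟨s', u, rfl⟩
    · simp at hl
    · rw [List.concat_eq_append] at hs hp hl
      exact ⟨u, s', hs, by simpa using hl, hp⟩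
  · rintro ⟨v, s, hs, hl, hp⟩
    exact ⟨_, hs, by simpa using hl, hp⟩

/-- `π` has an increasing subsequence of length `c` that ends with the value `v`. -/
abbrev EndsInc : List ℕ → ℕ → ℕ → Prop := EndsChain (· < ·)

/-- `π` has a decreasing subsequence of length `r` that ends with the value `v`. -/
abbrev EndsDec : List ℕ → ℕ → ℕ → Prop := EndsChain (· > ·)

theorem containsI_succ {π : List ℕ} {k : ℕ} : ContainsI (k + 1) π ↔ ∃ v, EndsInc π v (k + 1) :=
  exists_endsChain_iff

theorem containsJ_succ {π : List ℕ} {k : ℕ} : ContainsJ (k + 1) π ↔ ∃ v, EndsDec π v (k + 1) :=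
  exists_endsChain_iff

/-- Of the two entries the later one extends chains ending at the earlier one: increasing chains if
`v` is later, decreasing chains if `u` is. This is the heart of the Erdős–Szekeres theorem. -/
theorem inc_extends_or_dec_extends {π : List ℕ} (hπ : π.Nodup) {u v : ℕ} (hu : u ∈ π)
    (hv : v ∈ π) (huv : u < v) :
    (∀ c, EndsInc π u c → EndsInc π v (c + 1)) ∨ (∀ r, EndsDec π v r → EndsDec π u (r + 1)) := by
  induction π using List.reverseRecOn with
  | nil => simp at hu
  | append_singleton l m ih =>
    have hm : m ∉ l := by
      rw [List.nodup_append] at hπ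
      exact fun h => hπ.2.2 m h m (by simp) rfl
    have hl : l.Nodup := (List.nodup_append.1 hπ).1
    by_cases hvm : v = m
    · subst hvm
      left
      intro c hc
      exact (EndsChain.append_singleton_self_iff hm).2
        (Or.inr ⟨u, huv, hc.append_singleton_of_ne huv.ne⟩)
    by_cases hum : u = m
    · subst hum
      right
      intro c hc
      exact (EndsChain.append_singleton_self_iff hm).2
        (Or.inr ⟨v, huv, hc.append_singleton_of_ne hvm⟩)
    have hu' : u ∈ l := by simpa [hum] using hu
    have hv' : v ∈ l := by simpa [hvm] using hv
    refine (ih hl hu' hv').imp (fun h c hc => ?_) (fun h c hc => ?_)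
    · exact (h c (hc.append_singleton_of_ne hum)).append_right _
    · exact (h c (hc.append_singleton_of_ne hvm)).append_right _

/-! ### Effect of an appended digit on chains -/

/-- The relabelling of the digits of a permutation when the digit `m` is appended. -/
def raise (m x : ℕ) : ℕ := if x < m then x else x + 1

theorem raise_lt_raise {m x y : ℕ} : raise m x < raise m y ↔ x < y := by
  unfold raise; split_ifs <;> omega

theorem raise_lt {m x : ℕ} : raise m x < m ↔ x < m := by
  unfold raise; split_ifs <;> omega

theorem lt_raise {m x : ℕ} : m < raise m x ↔ m ≤ x := by
  unfold raise; split_ifs <;> omega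

theorem raise_ne {m x : ℕ} : raise m x ≠ m := by
  unfold raise; split_ifs <;> omega

theorem raise_injective (m : ℕ) : Function.Injective (raise m) := by
  intro x y h
  unfold raise at h
  split_ifs at h <;> omega

theorem appendDigit_eq (π : List ℕ) (m : ℕ) : appendDigit π m = π.map (raise m) ++ [m] := rfl

theorem length_appendDigit (π : List ℕ) (m : ℕ) : (appendDigit π m).length = π.length + 1 := by
  simp [appendDigit_eq]

theorem notMem_map_raise (π : List ℕ) (m : ℕ) : m ∉ π.map (raise m) := by
  simp [raise_ne]

theorem endsInc_map_raise {π : List ℕ} {m v c : ℕ} :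
    EndsInc (π.map (raise m)) (raise m v) c ↔ EndsInc π v c :=
  EndsChain.map_iff (raise_injective m) fun _ _ => raise_lt_raise

theorem endsDec_map_raise {π : List ℕ} {m v c : ℕ} :
    EndsDec (π.map (raise m)) (raise m v) c ↔ EndsDec π v c :=
  EndsChain.map_iff (raise_injective m) fun _ _ => raise_lt_raise

theorem endsInc_appendDigit_raise {π : List ℕ} {m v c : ℕ} :
    EndsInc (appendDigit π m) (raise m v) c ↔ EndsInc π v c := by
  rw [← endsInc_map_raise (π := π) (m := m)]
  exact ⟨fun h => h.append_singleton_of_ne raise_ne, fun h => h.append_right _⟩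

theorem endsDec_appendDigit_raise {π : List ℕ} {m v c : ℕ} :
    EndsDec (appendDigit π m) (raise m v) c ↔ EndsDec π v c := by
  rw [← endsDec_map_raise (π := π) (m := m)]
  exact ⟨fun h => h.append_singleton_of_ne raise_ne, fun h => h.append_right _⟩

theorem endsInc_appendDigit_self {π : List ℕ} {m c : ℕ} :
    EndsInc (appendDigit π m) m (c + 1) ↔ c = 0 ∨ ∃ u < m, EndsInc π u c := by
  rw [appendDigit_eq, EndsInc, EndsChain.append_singleton_self_iff (notMem_map_raise π m)]
  refine or_congr_right ⟨?_, ?_⟩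
  · rintro ⟨u, hu, h⟩
    obtain ⟨w, -, rfl⟩ := List.mem_map.1 h.mem
    exact ⟨w, raise_lt.1 hu, endsInc_map_raise.1 h⟩
  · rintro ⟨w, hw, h⟩
    exact ⟨raise m w, raise_lt.2 hw,
      endsInc_map_raise.2 h⟩

/-- The bound is weak, unlike in the increasing case, because an old entry equal to `m` is raised
above the new digit. -/
theorem endsDec_appendDigit_self {π : List ℕ} {m c : ℕ} :
    EndsDec (appendDigit π m) m (c + 1) ↔ c = 0 ∨ ∃ u, m ≤ u ∧ EndsDec π u c := by
  rw [appendDigit_eq, EndsDec, EndsChain.append_singleton_self_iff (notMem_map_raise π m)]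
  refine or_congr_right ⟨?_, ?_⟩
  · rintro ⟨u, hu, h⟩
    obtain ⟨w, -, rfl⟩ := List.mem_map.1 h.mem
    exact ⟨w, lt_raise.1 hu, endsDec_map_raise.1 h⟩
  · rintro ⟨w, hw, h⟩
    exact ⟨raise m w, lt_raise.2 hw,
      endsDec_map_raise.2 h⟩

theorem mem_appendDigit {π : List ℕ} {m v : ℕ} :
    v ∈ appendDigit π m ↔ v = m ∨ ∃ u ∈ π, v = raise m u := by
  simp only [appendDigit_eq, List.mem_append, List.mem_map, List.mem_singleton]
  rw [or_comm]
  exact or_congr_right ⟨fun ⟨u, h, e⟩ => ⟨u, h, e.symm⟩, fun ⟨u, h, e⟩ => ⟨u, h, e.symm⟩⟩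

/-- The entries of `π` are distinct and lie between `1` and the length of `π`. -/
structure IsPerm (π : List ℕ) : Prop where
  nodup : π.Nodup
  pos : ∀ v ∈ π, 1 ≤ v
  le : ∀ v ∈ π, v ≤ π.length

theorem isPerm_nil : IsPerm [] := ⟨by simp, by simp, by simp⟩

theorem IsPerm.appendDigit {π : List ℕ} (h : IsPerm π) {m : ℕ} (h₁ : 1 ≤ m)
    (h₂ : m ≤ π.length + 1) : IsPerm (appendDigit π m) := by
  refine ⟨?_, fun v hv => ?_, fun v hv => ?_⟩
  · rw [appendDigit_eq]
    refine List.Nodup.append (h.nodup.map (raise_injective m)) (by simp) ?_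
    simpa using fun x _ => raise_ne
  · rcases mem_appendDigit.1 hv with rfl | ⟨u, hu, rfl⟩
    · exact h₁
    · have := h.pos u hu
      unfold raise; split_ifs <;> omega
  · rw [length_appendDigit]
    rcases mem_appendDigit.1 hv with rfl | ⟨u, hu, rfl⟩
    · exact h₂
    · have := h.le u hu
      unfold raise; split_ifs <;> omega

/-! ### Labels of entries and the shaded region -/

/-- Some entry of `π` ends an increasing subsequence of length `x.1` and a decreasing subsequence
of length `x.2`. -/
def Shaded (π : List ℕ) (x : ℕ × ℕ) : Prop := ∃ v, EndsInc π v x.1 ∧ EndsDec π v x.2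

theorem Shaded.mono {π : List ℕ} {x y : ℕ × ℕ} (h : Shaded π x) (h₁ : 1 ≤ y.1) (h₂ : 1 ≤ y.2)
    (h₁' : y.1 ≤ x.1) (h₂' : y.2 ≤ x.2) : Shaded π y := by
  obtain ⟨v, hi, hj⟩ := h
  exact ⟨v, hi.of_le h₁ h₁', hj.of_le h₂ h₂'⟩

/-- The entry `m` of `π` ends increasing subsequences of lengths up to `x.1` and decreasing
subsequences of lengths up to `x.2`. -/
structure HasLabel (π : List ℕ) (m : ℕ) (x : ℕ × ℕ) : Prop where
  inc : ∀ c, EndsInc π m c ↔ 1 ≤ c ∧ c ≤ x.1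
  dec : ∀ r, EndsDec π m r ↔ 1 ≤ r ∧ r ≤ x.2

theorem exists_greatest_chain {R : ℕ → ℕ → Prop} {π : List ℕ} {m : ℕ} (h : m ∈ π) :
    ∃ f, ∀ c, EndsChain R π m c ↔ 1 ≤ c ∧ c ≤ f := by
  classical
  refine ⟨Nat.findGreatest (EndsChain R π m) π.length, fun c => ⟨fun hc => ?_, fun hc => ?_⟩⟩
  · exact ⟨hc.pos, Nat.le_findGreatest hc.le_length hc⟩
  · have h1 : 1 ≤ π.length := (EndsChain.one (R := R) h).le_length
    exact (Nat.findGreatest_spec h1 (EndsChain.one h)).of_le hc.1 hc.2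

theorem exists_hasLabel {π : List ℕ} {m : ℕ} (h : m ∈ π) : ∃ x, HasLabel π m x := by
  obtain ⟨f, hf⟩ := exists_greatest_chain (R := (· < ·)) h
  obtain ⟨g, hg⟩ := exists_greatest_chain (R := (· > ·)) h
  exact ⟨(f, g), hf, hg⟩

theorem HasLabel.one_le {π : List ℕ} {m : ℕ} {x : ℕ × ℕ} (h : HasLabel π m x) (hm : m ∈ π) :
    1 ≤ x.1 ∧ 1 ≤ x.2 :=
  ⟨((h.inc 1).1 (EndsChain.one hm)).2, ((h.dec 1).1 (EndsChain.one hm)).2⟩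

theorem hasLabel_of {π : List ℕ} {m x y : ℕ} (h₁ : EndsInc π m x) (h₂ : ¬ EndsInc π m (x + 1))
    (h₃ : EndsDec π m y) (h₄ : ¬ EndsDec π m (y + 1)) : HasLabel π m (x, y) := by
  refine ⟨fun c => ⟨fun h => ⟨h.pos, ?_⟩, fun h => h₁.of_le h.1 h.2⟩,
    fun c => ⟨fun h => ⟨h.pos, ?_⟩, fun h => h₃.of_le h.1 h.2⟩⟩
  · by_contra! hc
    exact h₂ (h.of_le (by omega) hc)
  · by_contra! hc
    exact h₄ (h.of_le (by omega) hc)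

theorem mem_board {cols rows : ℕ} {x : ℕ × ℕ} :
    x ∈ board cols rows ↔ (1 ≤ x.1 ∧ x.1 ≤ cols) ∧ 1 ≤ x.2 ∧ x.2 ≤ rows := by
  simp [board]

/-- Old entries keep their labels under relabelling, so only the rectangle below the new label is
added. This is the move rule of the board game. -/
theorem shaded_appendDigit {π : List ℕ} {m : ℕ} {x y : ℕ × ℕ}
    (h : HasLabel (appendDigit π m) m x) :
    Shaded (appendDigit π m) y ↔ Shaded π y ∨ y ∈ board x.1 x.2 := by
  rw [mem_board]
  constructor
  · rintro ⟨v, hi, hj⟩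
    rcases mem_appendDigit.1 hi.mem with rfl | ⟨u, -, rfl⟩
    · exact Or.inr ⟨(h.inc _).1 hi, (h.dec _).1 hj⟩
    · exact Or.inl ⟨u, endsInc_appendDigit_raise.1 hi, endsDec_appendDigit_raise.1 hj⟩
  · rintro (⟨u, hi, hj⟩ | ⟨h₁, h₂⟩)
    · exact ⟨_, endsInc_appendDigit_raise.2 hi, endsDec_appendDigit_raise.2 hj⟩
    · exact ⟨m, (h.inc _).2 h₁, (h.dec _).2 h₂⟩

/-- The label of an appended digit is a new cell next to the shaded region. -/
theorem label_adjacent {π : List ℕ} (hπ : π.Nodup) {m : ℕ} {x : ℕ × ℕ}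
    (h : HasLabel (appendDigit π m) m x) :
    ¬ Shaded π x ∧ ((π = [] ∧ x = (1, 1)) ∨ ∃ y, Shaded π y ∧ EdgeAdjacent y x) := by
  obtain ⟨f, g⟩ := x
  have hm : m ∈ appendDigit π m := mem_appendDigit.2 (Or.inl rfl)
  obtain ⟨hf, hg⟩ : 1 ≤ f ∧ 1 ≤ g := h.one_le hm
  have hI : ∀ u, u < m → ¬ EndsInc π u f := fun u hu hc => by
    have := (h.inc _).1 (endsInc_appendDigit_self.2 (Or.inr ⟨u, hu, hc⟩))
    simp at this
  have hJ : ∀ u, m ≤ u → ¬ EndsDec π u g := fun u hu hc => by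
    have := (h.dec _).1 (endsDec_appendDigit_self.2 (Or.inr ⟨u, hu, hc⟩))
    simp at this
  have hI' : 2 ≤ f → ∃ u < m, EndsInc π u (f - 1) := fun h2 => by
    have h3 := (h.inc f).2 ⟨hf, le_rfl⟩
    obtain ⟨k, rfl⟩ : ∃ k, f = k + 1 := ⟨f - 1, by omega⟩
    exact (endsInc_appendDigit_self.1 h3).resolve_left (by omega)
  have hJ' : 2 ≤ g → ∃ u, m ≤ u ∧ EndsDec π u (g - 1) := fun h2 => by
    have h3 := (h.dec g).2 ⟨hg, le_rfl⟩
    obtain ⟨k, rfl⟩ : ∃ k, g = k + 1 := ⟨g - 1, by omega⟩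
    exact (endsDec_appendDigit_self.1 h3).resolve_left (by omega)
  refine ⟨?_, ?_⟩
  · rintro ⟨v, hi, hj⟩
    rcases lt_or_ge v m with hv | hv
    · exact hI v hv hi
    · exact hJ v hv hj
  by_cases hf2 : 2 ≤ f
  · obtain ⟨v, hv, hi⟩ := hI' hf2
    by_cases hj : EndsDec π v g
    · exact Or.inr ⟨(f - 1, g), ⟨v, hi, hj⟩, by simp only [EdgeAdjacent, true_and]; omega⟩
    have hg2 : 2 ≤ g := by
      by_contra! hlt
      obtain rfl : g = 1 := by omega
      exact hj (EndsChain.one hi.mem)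
    -- Here `v < m ≤ w`, with `v` ending an increasing chain of length `f - 1` and `w` a decreasing
    -- one of length `g - 1`. If `w` is the later of the two, the cell `(f, g - 1)` is shaded;
    -- otherwise `v` would end a decreasing chain of length `g`, which was excluded.
    obtain ⟨w, hw, hj'⟩ := hJ' hg2
    rcases inc_extends_or_dec_extends hπ hi.mem hj'.mem (by omega) with h1 | h1
    · have := h1 _ hi
      rw [Nat.sub_add_cancel hf] at this
      exact Or.inr ⟨(f, g - 1), ⟨w, this, hj'⟩, by simp only [EdgeAdjacent, true_and]; omega⟩
    · have := h1 _ hj'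
      rw [Nat.sub_add_cancel hg] at this
      exact absurd this hj
  · obtain rfl : f = 1 := by omega
    by_cases hg2 : 2 ≤ g
    · obtain ⟨w, hw, hj'⟩ := hJ' hg2
      exact Or.inr ⟨(1, g - 1), ⟨w, EndsChain.one hj'.mem, hj'⟩, by
        simp only [EdgeAdjacent, true_and]; omega⟩
    · obtain rfl : g = 1 := by omega
      refine Or.inl ⟨List.eq_nil_iff_forall_not_mem.2 fun v hv => ?_, rfl⟩
      rcases lt_or_ge v m with h1 | h1
      · exact hI v h1 (EndsChain.one hv)
      · exact hJ v h1 (EndsChain.one hv)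

/-- Every unshaded cell that shares an edge with a shaded one is the label of some digit. -/
theorem exists_digit_of_adjacent {π : List ℕ} (hπ : IsPerm π) {x : ℕ × ℕ} (hx₁ : 1 ≤ x.1)
    (hx₂ : 1 ≤ x.2) (hx : ¬ Shaded π x) (hy : ∃ y, Shaded π y ∧ EdgeAdjacent y x) :
    ∃ m, 1 ≤ m ∧ m ≤ π.length + 1 ∧ HasLabel (appendDigit π m) m x := by
  classical
  obtain ⟨x₁, x₂⟩ := x
  obtain ⟨⟨y₁, y₂⟩, hs, hadj⟩ := hy
  simp only [EdgeAdjacent] at hadj hx₁ hx₂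
  have hmono : ¬ (x₁ ≤ y₁ ∧ x₂ ≤ y₂) := fun h => hx (hs.mono hx₁ hx₂ h.1 h.2)
  obtain ⟨v, hi, hj⟩ := hs
  simp only at hi hj
  -- Shading is closed downwards, so the shaded neighbour has the smaller coordinate.
  have key : (y₂ + 1 = x₂ ∧ y₁ = x₁) ∨ (y₁ + 1 = x₁ ∧ y₂ = x₂) := by omega
  rcases key with ⟨rfl, rfl⟩ | ⟨rfl, rfl⟩
  · have hex : ∃ w, EndsInc π w y₁ := ⟨v, hi⟩
    -- The new digit goes just below the least value `w` that ends an increasing chain of length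
    -- `y₁`: nothing below it can push its first coordinate beyond `y₁`, while `v ≥ w` gives a
    -- decreasing chain of length `y₂ + 1`. A longer one would come from some `u ≥ w`, and comparing
    -- `u` with `w` would show that the target cell is already shaded.
    obtain ⟨w, hw, hmin⟩ : ∃ w, EndsInc π w y₁ ∧ ∀ u < w, ¬ EndsInc π u y₁ :=
      ⟨Nat.find hex, Nat.find_spec hex, fun u => Nat.find_min hex⟩
    have hwv : w ≤ v := by
      by_contra! h
      exact hmin v h hi
    refine ⟨w, hπ.pos w hw.mem, (hπ.le w hw.mem).trans (by omega), hasLabel_of ?_ ?_ ?_ ?_⟩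
    · obtain ⟨k, rfl⟩ : ∃ k, y₁ = k + 1 := ⟨y₁ - 1, by omega⟩
      rw [endsInc_appendDigit_self]
      rcases Nat.eq_zero_or_pos k with hk | hk
      · exact Or.inl hk
      · exact Or.inr (hw.pred hk)
    · rw [endsInc_appendDigit_self]
      rintro (h | ⟨u, hu, h⟩)
      · omega
      · exact hmin u hu h
    · exact endsDec_appendDigit_self.2 (Or.inr ⟨v, hwv, hj⟩)
    · rw [endsDec_appendDigit_self]
      rintro (h | ⟨u, hu, h⟩)
      · omega
      rcases hu.eq_or_lt with rfl | hu
      · exact hx ⟨_, hw, h⟩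
      · rcases inc_extends_or_dec_extends hπ.nodup hw.mem h.mem hu with h1 | h1
        · exact hx ⟨u, (h1 _ hw).of_succ hx₁, h⟩
        · exact hx ⟨w, hw, (h1 _ h).of_succ hx₂⟩
  -- Symmetrically, the new digit goes just above the greatest value `w` that ends a decreasing
  -- chain of length `y₂`.
  · obtain ⟨w, hw, hmax⟩ : ∃ w, EndsDec π w y₂ ∧ ∀ u, w < u → ¬ EndsDec π u y₂ := by
      have hv : v ≤ π.length := hπ.le v hj.mem
      refine ⟨Nat.findGreatest (fun w => EndsDec π w y₂) π.length,
        Nat.findGreatest_spec (P := fun w => EndsDec π w y₂) hv hj, fun u hu h => ?_⟩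
      exact hu.not_ge (Nat.le_findGreatest (P := fun w => EndsDec π w y₂) (hπ.le u h.mem) h)
    have hwv : v ≤ w := by
      by_contra! h
      exact hmax v h hj
    refine ⟨w + 1, by omega, by have := hπ.le w hw.mem; omega, hasLabel_of ?_ ?_ ?_ ?_⟩
    · exact endsInc_appendDigit_self.2 (Or.inr ⟨v, by omega, hi⟩)
    · rw [endsInc_appendDigit_self]
      rintro (h | ⟨u, hu, h⟩)
      · omega
      rcases (Nat.lt_succ_iff.1 hu).eq_or_lt with rfl | hu
      · exact hx ⟨_, h, hw⟩
      · rcases inc_extends_or_dec_extends hπ.nodup h.mem hw.mem hu with h1 | h1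
        · exact hx ⟨w, (h1 _ h).of_succ hx₁, hw⟩
        · exact hx ⟨u, h, (h1 _ hw).of_succ hx₂⟩
    · obtain ⟨k, rfl⟩ : ∃ k, y₂ = k + 1 := ⟨y₂ - 1, by omega⟩
      rw [endsDec_appendDigit_self]
      rcases Nat.eq_zero_or_pos k with hk | hk
      · exact Or.inl hk
      · obtain ⟨z, hz, h⟩ := hw.pred hk
        exact Or.inr ⟨z, hz, h⟩
    · rw [endsDec_appendDigit_self]
      rintro (h | ⟨u, hu, h⟩)
      · omega
      · exact hmax u hu h

/-! ### Turns and uniqueness of the winner -/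

theorem Player.other_other (p : Player) : p.other.other = p := by cases p <;> rfl

theorem Player.other_ne (p : Player) : p.other ≠ p := by cases p <;> simp [Player.other]

theorem Player.eq_other_of_ne {p q : Player} (h : p ≠ q) : p = q.other := by
  cases p <;> cases q <;> simp_all [Player.other]

theorem playerAfter_succ (n : ℕ) : playerAfter (n + 1) = (playerAfter n).other := by
  unfold playerAfter
  by_cases h : Even n <;> simp [h, Nat.even_add_one, Player.other]

theorem playerAfter_appendDigit (π : List ℕ) (m : ℕ) :
    playerAfter (appendDigit π m).length = (playerAfter π.length).other := by
  rw [length_appendDigit, playerAfter_succ]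

theorem WinsFrom.winner_eq {P M : Type} {G : TurnGame P M} {p : Player} {σ : P → M} {x : P}
    (h : WinsFrom G p σ x) (hx : G.Over x) : G.winner x = p := by
  cases h with
  | ended _ _ hw => exact hw
  | own _ h => exact absurd hx h
  | opp _ h => exact absurd hx h

/-- At most one player can win from a given position. -/
theorem WinsFrom.player_unique {P M : Type} {G : TurnGame P M} {p q : Player} {σ τ : P → M} {x : P}
    (h : WinsFrom G p σ x) (h' : WinsFrom G q τ x) : p = q := by
  induction h with
  | ended x hx hw => exact hw.symm.trans (h'.winner_eq hx)
  | own x hx ht hl _ ih =>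
    cases h' with
    | ended _ hx' => exact absurd hx' hx
    | own _ _ ht' => exact ht.symm.trans ht'
    | opp _ _ _ hn' => exact ih (hn' _ hl)
  | opp x hx ht _ ih =>
    cases h' with
    | ended _ hx' => exact absurd hx' hx
    | own _ _ _ hl' hn' => exact ih _ hl' hn'
    | opp _ _ ht' => rw [Player.eq_other_of_ne ht.symm, Player.eq_other_of_ne ht'.symm]

theorem HasWinningStrategy.player_unique {P M : Type} {G : TurnGame P M} {p q : Player}
    (h : HasWinningStrategy G p) (h' : HasWinningStrategy G q) : p = q := by
  obtain ⟨σ, hσ⟩ := h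
  obtain ⟨τ, hτ⟩ := h'
  exact WinsFrom.player_unique hσ hτ

/-! ### Achievement versus avoidance -/

theorem ContainsI.of_succ {a : ℕ} {π : List ℕ} (h : ContainsI (a + 1) π) : ContainsI a π := by
  obtain ⟨s, hs, hl, hp⟩ := h
  cases s with
  | nil => simp at hl
  | cons x s => exact ⟨s, (List.sublist_cons_self _ _).trans hs, by simpa using hl, hp.of_cons⟩

theorem ContainsJ.of_succ {b : ℕ} {π : List ℕ} (h : ContainsJ (b + 1) π) : ContainsJ b π := by
  obtain ⟨s, hs, hl, hp⟩ := h
  cases s with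
  | nil => simp at hl
  | cons x s => exact ⟨s, (List.sublist_cons_self _ _).trans hs, by simpa using hl, hp.of_cons⟩

/-- Only the last digit is new, so deleting it costs an increasing subsequence at most one entry.
Hence the achievement game cannot end before the shorter pattern has been present for a move. -/
theorem ContainsI.of_appendDigit {a : ℕ} {π : List ℕ} {m : ℕ}
    (h : ContainsI (a + 1) (appendDigit π m)) : ContainsI a π := by
  rcases Nat.eq_zero_or_pos a with rfl | ha
  · exact ⟨[], by simp, rfl, by simp⟩
  obtain ⟨k, rfl⟩ : ∃ k, a = k + 1 := ⟨a - 1, by omega⟩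
  obtain ⟨v, hv⟩ := containsI_succ.1 h
  rw [containsI_succ]
  rcases mem_appendDigit.1 hv.mem with rfl | ⟨u, -, rfl⟩
  · obtain ⟨u, -, hu⟩ := (endsInc_appendDigit_self.1 hv).resolve_left (by omega)
    exact ⟨u, hu⟩
  · exact ⟨u, (endsInc_appendDigit_raise.1 hv).of_succ ha⟩

theorem ContainsJ.of_appendDigit {b : ℕ} {π : List ℕ} {m : ℕ}
    (h : ContainsJ (b + 1) (appendDigit π m)) : ContainsJ b π := by
  rcases Nat.eq_zero_or_pos b with rfl | hb
  · exact ⟨[], by simp, rfl, by simp⟩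
  obtain ⟨k, rfl⟩ : ∃ k, b = k + 1 := ⟨b - 1, by omega⟩
  obtain ⟨v, hv⟩ := containsJ_succ.1 h
  rw [containsJ_succ]
  rcases mem_appendDigit.1 hv.mem with rfl | ⟨u, -, rfl⟩
  · obtain ⟨u, -, hu⟩ := (endsDec_appendDigit_self.1 hv).resolve_left (by omega)
    exact ⟨u, hu⟩
  · exact ⟨u, (endsDec_appendDigit_raise.1 hv).of_succ hb⟩

theorem ContainsI.appendDigit_top {a : ℕ} {π : List ℕ} (hπ : IsPerm π) (ha : 1 ≤ a)
    (h : ContainsI a π) : ContainsI (a + 1) (appendDigit π (π.length + 1)) := by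
  obtain ⟨k, rfl⟩ : ∃ k, a = k + 1 := ⟨a - 1, by omega⟩
  obtain ⟨v, hv⟩ := containsI_succ.1 h
  exact containsI_succ.2 ⟨_, endsInc_appendDigit_self.2
    (Or.inr ⟨v, Nat.lt_succ_of_le (hπ.le v hv.mem), hv⟩)⟩

theorem ContainsJ.appendDigit_one {b : ℕ} {π : List ℕ} (hπ : IsPerm π) (hb : 1 ≤ b)
    (h : ContainsJ b π) : ContainsJ (b + 1) (appendDigit π 1) := by
  obtain ⟨k, rfl⟩ : ∃ k, b = k + 1 := ⟨b - 1, by omega⟩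
  obtain ⟨v, hv⟩ := containsJ_succ.1 h
  exact containsJ_succ.2 ⟨_, endsDec_appendDigit_self.2 (Or.inr ⟨v, hπ.pos v hv.mem, hv⟩)⟩

theorem not_containsI_nil {a : ℕ} (ha : 1 ≤ a) : ¬ ContainsI a [] := by
  rintro ⟨s, hs, hl, -⟩
  simp [List.sublist_nil.1 hs] at hl
  omega

theorem not_containsJ_nil {b : ℕ} (hb : 1 ≤ b) : ¬ ContainsJ b [] := by
  rintro ⟨s, hs, hl, -⟩
  simp [List.sublist_nil.1 hs] at hl
  omega

/-- After a digit that creates `I_a` or `J_b`, the next player completes `I_(a+1)` or `J_(b+1)`. -/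
theorem exists_completing_digit {a b : ℕ} {π : List ℕ} (hπ : IsPerm π) (ha : 1 ≤ a) (hb : 1 ≤ b)
    (h : ContainsI a π ∨ ContainsJ b π) : ∃ m, (1 ≤ m ∧ m ≤ π.length + 1) ∧
      (ContainsI (a + 1) (appendDigit π m) ∨ ContainsJ (b + 1) (appendDigit π m)) := by
  rcases h with h | h
  · exact ⟨π.length + 1, by omega, Or.inl (h.appendDigit_top hπ ha)⟩
  · exact ⟨1, by omega, Or.inr (h.appendDigit_one hπ hb)⟩

/-- A winning achievement strategy can never be the first to create `I_a` or `J_b`, since the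
opponent would complete the longer pattern. So in every play it is the opponent who creates one, and
thereby loses the avoidance game. -/
theorem winsFrom_avoidance_of_achievement {a b : ℕ} (ha : 1 ≤ a) (hb : 1 ≤ b) {p : Player}
    {σ : List ℕ → ℕ} {π : List ℕ} (h : WinsFrom (esGame .achievement (a + 1) (b + 1)) p σ π)
    (hπ : IsPerm π) (hI : ¬ ContainsI a π) (hJ : ¬ ContainsJ b π) :
    WinsFrom (esGame .avoidance a b) p σ π := by
  induction h with
  | ended π h hw => exact absurd h (not_or.2 ⟨fun h => hI h.of_succ, fun h => hJ h.of_succ⟩)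
  | own π h ht hl hn ih =>
    refine .own π (not_or.2 ⟨hI, hJ⟩) ht hl ?_
    have hπ' : IsPerm (appendDigit π (σ π)) := hπ.appendDigit hl.1 hl.2
    by_cases hover : ContainsI a (appendDigit π (σ π)) ∨ ContainsJ b (appendDigit π (σ π))
    -- The longer pattern is not there yet, so it is the opponent's turn, and the completing digit
    -- `m` ends the game against `p`.
    · exfalso
      have hturn : playerAfter (appendDigit π (σ π)).length = p.other := by
        rw [playerAfter_appendDigit]
        exact congrArg _ ht
      obtain ⟨m, hm, hc⟩ := exists_completing_digit hπ' ha hb hover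
      cases hn with
      | ended _ h' => exact h'.elim (fun h => hI h.of_appendDigit) (fun h => hJ h.of_appendDigit)
      | own _ _ ht' => exact p.other_ne (hturn.symm.trans ht')
      | opp _ _ _ hn' =>
        have := (hn' m hm).winner_eq hc
        simp only [esGame, playerAfter_appendDigit, Player.other_other] at this
        rw [← this] at ht
        exact Player.other_ne _ ht.symm
    · exact ih hπ' (fun h => hover (Or.inl h)) (fun h => hover (Or.inr h))
  | opp π h ht hn ih =>
    refine .opp π (not_or.2 ⟨hI, hJ⟩) ht fun m hm => ?_
    by_cases hover : ContainsI a (appendDigit π m) ∨ ContainsJ b (appendDigit π m)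
    · refine .ended _ hover ?_
      simp only [esGame, playerAfter_appendDigit]
      exact (Player.eq_other_of_ne (Ne.symm ht)).symm
    · exact ih m hm (hπ.appendDigit hm.1 hm.2) (fun h => hover (Or.inl h))
        (fun h => hover (Or.inr h))

open Classical in
/-- Follow `σ` until `I_a` or `J_b` appears, then complete `I_(a+1)` or `J_(b+1)`. -/
noncomputable def completing (a b : ℕ) (σ : List ℕ → ℕ) (π : List ℕ) : ℕ :=
  if ContainsI a π then π.length + 1 else if ContainsJ b π then 1 else σ π

theorem completing_of_not {a b : ℕ} {σ : List ℕ → ℕ} {π : List ℕ} (hI : ¬ ContainsI a π)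
    (hJ : ¬ ContainsJ b π) : completing a b σ π = σ π := by
  simp [completing, hI, hJ]

/-- When the avoidance game ends in favour of `p`, it is `p`'s turn with a shorter pattern on the
table, and `completing` finishes the longer one. Until then a single digit cannot create the longer
pattern, so the hypotheses `hI` and `hJ` persist. -/
theorem winsFrom_achievement_of_avoidance {a b : ℕ} (ha : 1 ≤ a) (hb : 1 ≤ b) {p : Player}
    {σ : List ℕ → ℕ} {π : List ℕ} (h : WinsFrom (esGame .avoidance a b) p σ π)
    (hπ : IsPerm π) (hI : ¬ ContainsI (a + 1) π) (hJ : ¬ ContainsJ (b + 1) π) :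
    WinsFrom (esGame .achievement (a + 1) (b + 1)) p (completing a b σ) π := by
  induction h with
  | ended π h hw =>
    have hover : (esGame .achievement (a + 1) (b + 1)).Over
        (appendDigit π (completing a b σ π)) := by
      unfold completing
      split_ifs with h₁ h₂
      · exact Or.inl (h₁.appendDigit_top hπ ha)
      · exact Or.inr (h₂.appendDigit_one hπ hb)
      · exact absurd h (not_or.2 ⟨h₁, h₂⟩)
    refine .own π (not_or.2 ⟨hI, hJ⟩) hw ?_ (.ended _ hover ?_)
    · unfold completing
      split_ifs with h₁ h₂
      · exact ⟨by omega, le_rfl⟩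
      · exact ⟨le_rfl, by omega⟩
      · exact absurd h (not_or.2 ⟨h₁, h₂⟩)
    · simp only [esGame, playerAfter_appendDigit, Player.other_other]
      exact hw
  | own π h ht hl hn ih =>
    obtain ⟨h₁, h₂⟩ := not_or.1 h
    have hσ := completing_of_not (σ := σ) h₁ h₂
    refine .own π (not_or.2 ⟨hI, hJ⟩) ht ?_ ?_
    · rw [hσ]; exact hl
    · rw [hσ]
      exact ih (hπ.appendDigit hl.1 hl.2) (fun h => h₁ h.of_appendDigit)
        (fun h => h₂ h.of_appendDigit)
  | opp π h ht hn ih =>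
    obtain ⟨h₁, h₂⟩ := not_or.1 h
    exact .opp π (not_or.2 ⟨hI, hJ⟩) ht fun m hm =>
      ih m hm (hπ.appendDigit hm.1 hm.2) (fun h => h₁ h.of_appendDigit)
        (fun h => h₂ h.of_appendDigit)

theorem achievement_reduction {a b : ℕ} (ha : 1 ≤ a) (hb : 1 ≤ b) (p : Player) :
    (∀ σ, IsWinningStrategy (esGame .achievement (a + 1) (b + 1)) p σ →
      IsWinningStrategy (esGame .avoidance a b) p σ) ∧
    (∀ σ, IsWinningStrategy (esGame .avoidance a b) p σ →
      ∃ τ, IsWinningStrategy (esGame .achievement (a + 1) (b + 1)) p τ ∧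
        ∀ π, ¬ ContainsI a π → ¬ ContainsJ b π → τ π = σ π) :=
  ⟨fun _ h => winsFrom_avoidance_of_achievement ha hb h isPerm_nil (not_containsI_nil ha)
      (not_containsJ_nil hb),
    fun σ h => ⟨completing a b σ, winsFrom_achievement_of_avoidance ha hb h isPerm_nil
      (not_containsI_nil (by omega)) (not_containsJ_nil (by omega)),
      fun _ => completing_of_not⟩⟩

/-! ### Avoidance game versus board game -/

open Classical in
/-- The cells of the board that are shaded in the position `π`. -/
noncomputable def shadeOf (A B : ℕ) (π : List ℕ) : Finset (ℕ × ℕ) := {x ∈ board A B | Shaded π x}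

/-- The avoidance game for `I_(A+1)` and `J_(B+1)` has not ended in the position `π`. -/
structure Alive (A B : ℕ) (π : List ℕ) : Prop extends IsPerm π where
  notI : ¬ ContainsI (A + 1) π
  notJ : ¬ ContainsJ (B + 1) π

theorem alive_nil (A B : ℕ) : Alive A B [] :=
  ⟨isPerm_nil, not_containsI_nil (by omega), not_containsJ_nil (by omega)⟩

theorem Alive.mem_board {A B : ℕ} {π : List ℕ} (h : Alive A B π) {x : ℕ × ℕ} (hx : Shaded π x) :
    x ∈ board A B := by
  obtain ⟨v, hi, hj⟩ := hx
  rw [ErdosSzekeres.mem_board]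
  refine ⟨⟨hi.pos, ?_⟩, hj.pos, ?_⟩
  · by_contra! hc
    exact h.notI (containsI_succ.2 ⟨v, hi.of_le (by omega) hc⟩)
  · by_contra! hc
    exact h.notJ (containsJ_succ.2 ⟨v, hj.of_le (by omega) hc⟩)

theorem Alive.mem_shadeOf {A B : ℕ} {π : List ℕ} (h : Alive A B π) {x : ℕ × ℕ} :
    x ∈ shadeOf A B π ↔ Shaded π x := by
  simp only [shadeOf, Finset.mem_filter]
  exact ⟨fun h => h.2, fun hx => ⟨h.mem_board hx, hx⟩⟩

theorem Alive.shadeOf_appendDigit {A B : ℕ} {π : List ℕ} (h : Alive A B π) {m : ℕ} {x : ℕ × ℕ}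
    (hx : HasLabel (appendDigit π m) m x) (h' : Alive A B (appendDigit π m)) :
    shadeOf A B (appendDigit π m) = shadeOf A B π ∪ board x.1 x.2 := by
  ext y
  rw [h'.mem_shadeOf, Finset.mem_union, h.mem_shadeOf, shaded_appendDigit hx]

/-- A digit keeps the avoidance game going exactly if its label is a cell of the board. -/
theorem Alive.appendDigit_iff {A B : ℕ} {π : List ℕ} (h : Alive A B π) {m : ℕ} {x : ℕ × ℕ}
    (h₁ : 1 ≤ m) (h₂ : m ≤ π.length + 1) (hx : HasLabel (appendDigit π m) m x) :
    Alive A B (appendDigit π m) ↔ x ∈ board A B := by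
  have hm := hx.one_le (mem_appendDigit.2 (Or.inl rfl))
  constructor
  · intro h'
    exact h'.mem_board ⟨m, (hx.inc _).2 ⟨hm.1, le_rfl⟩, (hx.dec _).2 ⟨hm.2, le_rfl⟩⟩
  · intro hb
    rw [ErdosSzekeres.mem_board] at hb
    refine ⟨h.toIsPerm.appendDigit h₁ h₂, fun hc => ?_, fun hc => ?_⟩
    · obtain ⟨v, hv⟩ := containsI_succ.1 hc
      rcases mem_appendDigit.1 hv.mem with rfl | ⟨u, -, rfl⟩
      · have := (hx.inc _).1 hv
        omega
      · exact h.notI (containsI_succ.2 ⟨u, endsInc_appendDigit_raise.1 hv⟩)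
    · obtain ⟨v, hv⟩ := containsJ_succ.1 hc
      rcases mem_appendDigit.1 hv.mem with rfl | ⟨u, -, rfl⟩
      · have := (hx.dec _).1 hv
        omega
      · exact h.notJ (containsJ_succ.2 ⟨u, endsDec_appendDigit_raise.1 hv⟩)

theorem Alive.over_of_not {A B : ℕ} {π : List ℕ} (h : IsPerm π) (h' : ¬ Alive A B π) :
    ContainsI (A + 1) π ∨ ContainsJ (B + 1) π := by
  by_contra! hc
  exact h' ⟨h, hc.1, hc.2⟩

theorem Alive.not_over {A B : ℕ} {π : List ℕ} (h : Alive A B π) :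
    ¬ (esGame .avoidance (A + 1) (B + 1)).Over π := not_or.2 ⟨h.notI, h.notJ⟩

/-- The position of the board game that belongs to the permutation `π`. -/
noncomputable def boardPosition (A B : ℕ) (π : List ℕ) : Finset (ℕ × ℕ) × Player :=
  (shadeOf A B π, playerAfter π.length)

theorem boardPosition_nil (A B : ℕ) : boardPosition A B [] = (boardGame A B).start := by
  have : shadeOf A B [] = ∅ := by
    ext x
    rw [(alive_nil A B).mem_shadeOf]
    simp only [Finset.notMem_empty, iff_false]
    rintro ⟨v, hi, -⟩
    simpa using hi.mem
  simp [boardPosition, this, boardGame, playerAfter]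

theorem Alive.boardPosition_appendDigit {A B : ℕ} {π : List ℕ} (h : Alive A B π) {m : ℕ}
    {x : ℕ × ℕ} (hx : HasLabel (appendDigit π m) m x) (h' : Alive A B (appendDigit π m)) :
    boardPosition A B (appendDigit π m) = (boardGame A B).next (boardPosition A B π) x := by
  simp only [boardPosition, h.shadeOf_appendDigit hx h', playerAfter_appendDigit]
  rfl

theorem Alive.legal_of_hasLabel {A B : ℕ} {π : List ℕ} (h : Alive A B π) {m : ℕ} {x : ℕ × ℕ}
    (hx : HasLabel (appendDigit π m) m x) (h' : x ∈ board A B) :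
    (boardGame A B).Legal (boardPosition A B π) x := by
  obtain ⟨h₁, h₂⟩ := label_adjacent h.nodup hx
  refine ⟨h', fun hc => h₁ (h.mem_shadeOf.1 hc), h₂.imp ?_ ?_⟩
  · rintro ⟨rfl, rfl⟩
    exact ⟨congrArg Prod.fst (boardPosition_nil A B), rfl⟩
  · rintro ⟨y, hy, ha⟩
    exact ⟨y, h.mem_shadeOf.2 hy, ha⟩

theorem Alive.exists_digit_of_legal {A B : ℕ} {π : List ℕ} (h : Alive A B π) {x : ℕ × ℕ}
    (hx : (boardGame A B).Legal (boardPosition A B π) x) :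
    ∃ m, (1 ≤ m ∧ m ≤ π.length + 1) ∧ HasLabel (appendDigit π m) m x := by
  obtain ⟨h₁, h₂, h₃⟩ := hx
  have hb := ErdosSzekeres.mem_board.1 h₁
  have hs : ¬ Shaded π x := fun hc => h₂ (h.mem_shadeOf.2 hc)
  rcases h₃ with ⟨he, rfl⟩ | ⟨y, hy, ha⟩
  · have hnil : π = [] := by
      refine List.eq_nil_iff_forall_not_mem.2 fun v hv => hs ?_
      exact ⟨v, EndsChain.one hv, EndsChain.one hv⟩
    subst hnil
    -- The empty permutation shades nothing, so adjacency leaves `(1, 1)` as the only possible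
    -- label.
    obtain ⟨x, hx⟩ := exists_hasLabel (π := appendDigit [] 1) (m := 1) (by simp [appendDigit])
    obtain ⟨-, ⟨-, rfl⟩ | ⟨y, ⟨v, hi, -⟩, -⟩⟩ := label_adjacent (by simp) hx
    · exact ⟨1, by simp, hx⟩
    · exact absurd hi.mem (by simp)
  · obtain ⟨m, hm₁, hm₂, hm⟩ := exists_digit_of_adjacent h.toIsPerm hb.1.1 hb.2.1 hs
      ⟨y, h.mem_shadeOf.1 hy, ha⟩
    exact ⟨m, ⟨hm₁, hm₂⟩, hm⟩

theorem Alive.exists_label {π : List ℕ} (m : ℕ) : ∃ x, HasLabel (appendDigit π m) m x :=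
  exists_hasLabel (mem_appendDigit.2 (Or.inl rfl))

open Classical in
/-- The strategy for the avoidance game that imitates a strategy `σ` for the board game. -/
noncomputable def digitStrategy (A B : ℕ) (σ : Finset (ℕ × ℕ) × Player → ℕ × ℕ) (π : List ℕ) : ℕ :=
  -- The default is irrelevant where `σ` names a legal cell: such a cell is the label of a digit.
  if h : ∃ m, (1 ≤ m ∧ m ≤ π.length + 1) ∧
    HasLabel (appendDigit π m) m (σ (boardPosition A B π)) then h.choose else 1

/-- Digits that keep the game alive correspond to legal cells, so the two plays run in parallel; a
digit with a label off the board loses for the opponent who appends it. -/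
theorem winsFrom_avoidance_of_board {A B : ℕ} {p : Player}
    {σ : Finset (ℕ × ℕ) × Player → ℕ × ℕ} {s : Finset (ℕ × ℕ) × Player}
    (h : WinsFrom (boardGame A B) p σ s) {π : List ℕ} (hπ : Alive A B π)
    (hs : boardPosition A B π = s) :
    WinsFrom (esGame .avoidance (A + 1) (B + 1)) p (digitStrategy A B σ) π := by
  have lose : ∀ {π : List ℕ}, IsPerm π → ¬ Alive A B π → playerAfter π.length = p →
      WinsFrom (esGame .avoidance (A + 1) (B + 1)) p (digitStrategy A B σ) π :=
    fun hπ h hp => .ended _ (Alive.over_of_not hπ h) hp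
  induction h generalizing π with
  | ended s hover hw =>
    subst hs
    -- The board is full and the opponent is to move; labels being unshaded, every digit now falls
    -- off the board.
    have ht : playerAfter π.length ≠ p := fun hc => by
      rw [← hc] at hw
      exact Player.other_ne _ hw
    refine .opp π hπ.not_over ht fun m hm => ?_
    refine lose (hπ.toIsPerm.appendDigit hm.1 hm.2) (fun h' => ?_) ?_
    · obtain ⟨x, hx⟩ := Alive.exists_label (π := π) m
      have hb := (hπ.appendDigit_iff hm.1 hm.2 hx).1 h'
      exact (label_adjacent hπ.nodup hx).1 (hπ.mem_shadeOf.1 (hover hb))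
    · exact (playerAfter_appendDigit π m).trans hw
  | own s hover ht hl hn ih =>
    subst hs
    have hex := hπ.exists_digit_of_legal hl
    have hτ : digitStrategy A B σ π = hex.choose := dif_pos hex
    obtain ⟨hm, hx⟩ := hex.choose_spec
    rw [← hτ] at hm hx
    have h' := (hπ.appendDigit_iff hm.1 hm.2 hx).2 hl.1
    exact .own π hπ.not_over ht hm (ih h' (hπ.boardPosition_appendDigit hx h'))
  | opp s hover ht hn ih =>
    subst hs
    refine .opp π hπ.not_over ht fun m hm => ?_
    obtain ⟨x, hx⟩ := Alive.exists_label (π := π) m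
    by_cases h' : Alive A B (appendDigit π m)
    · exact ih x (hπ.legal_of_hasLabel hx ((hπ.appendDigit_iff hm.1 hm.2 hx).1 h')) h'
        (hπ.boardPosition_appendDigit hx h')
    · refine lose (hπ.toIsPerm.appendDigit hm.1 hm.2) h' ?_
      exact (playerAfter_appendDigit π m).trans (Player.eq_other_of_ne (Ne.symm ht)).symm

/-- The board position `s` belongs to a permutation from which `σ` wins the avoidance game. -/
def Represented (A B : ℕ) (p : Player) (σ : List ℕ → ℕ) (s : Finset (ℕ × ℕ) × Player) : Prop :=
  ∃ π, Alive A B π ∧ boardPosition A B π = s ∧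
    WinsFrom (esGame .avoidance (A + 1) (B + 1)) p σ π

open Classical in
/-- The strategy for the board game that imitates a strategy `σ` for the avoidance game. -/
noncomputable def cellStrategy (A B : ℕ) (p : Player) (σ : List ℕ → ℕ)
    (s : Finset (ℕ × ℕ) × Player) : ℕ × ℕ :=
  if h : ∃ x, (boardGame A B).Legal s x ∧ Represented A B p σ ((boardGame A B).next s x)
    then h.choose else (1, 1)

theorem card_sdiff_next_lt {A B : ℕ} {s : Finset (ℕ × ℕ) × Player} {x : ℕ × ℕ}
    (h : (boardGame A B).Legal s x) :
    (board A B \ ((boardGame A B).next s x).1).card < (board A B \ s.1).card := by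
  have hb := mem_board.1 h.1
  have hx : x ∈ board x.1 x.2 := mem_board.2 ⟨⟨hb.1.1, le_rfl⟩, hb.2.1, le_rfl⟩
  refine Finset.card_lt_card ⟨Finset.sdiff_subset_sdiff le_rfl Finset.subset_union_left, fun hc => ?_⟩
  have := hc (Finset.mem_sdiff.2 ⟨h.1, h.2.1⟩)
  exact (Finset.mem_sdiff.1 this).2 (Finset.mem_union_right _ hx)

/-- Different permutations can yield the same board position, so `σ` does not determine a cell
directly. `cellStrategy` merely moves to some represented position, possibly changing the
representative each time; therefore the induction is on the number of open cells rather than on the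
play of `σ`. -/
theorem winsFrom_board_of_represented {A B : ℕ} {p : Player} {σ : List ℕ → ℕ} :
    ∀ (n : ℕ) {s : Finset (ℕ × ℕ) × Player}, (board A B \ s.1).card = n →
      Represented A B p σ s → WinsFrom (boardGame A B) p (cellStrategy A B p σ) s := by
  intro n
  induction n using Nat.strong_induction_on with
  | _ n ih =>
    rintro s hn ⟨π, hπ, rfl, hw⟩
    have step : ∀ x, (boardGame A B).Legal (boardPosition A B π) x →
        Represented A B p σ ((boardGame A B).next (boardPosition A B π) x) →
        WinsFrom (boardGame A B) p (cellStrategy A B p σ)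
          ((boardGame A B).next (boardPosition A B π) x) :=
      fun x hl hr => ih _ (hn ▸ card_sdiff_next_lt hl) rfl hr
    -- A digit of `σ` that created a pattern would lose for `p`, so its label is a legal cell.
    have main : playerAfter π.length = p → ∃ x, (boardGame A B).Legal (boardPosition A B π) x ∧
        Represented A B p σ ((boardGame A B).next (boardPosition A B π) x) := by
      intro ht
      cases hw with
      | ended _ h => exact absurd h hπ.not_over
      | opp _ _ h => exact absurd ht h
      | own _ h _ hl hn =>
        obtain ⟨x, hx⟩ := Alive.exists_label (π := π) (σ π)
        have h' : Alive A B (appendDigit π (σ π)) := by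
          by_contra hc
          have := hn.winner_eq (Alive.over_of_not (hπ.toIsPerm.appendDigit hl.1 hl.2) hc)
          simp only [esGame, playerAfter_appendDigit, ht] at this
          exact Player.other_ne _ this
        exact ⟨x, hπ.legal_of_hasLabel hx ((hπ.appendDigit_iff hl.1 hl.2 hx).1 h'),
          _, h', hπ.boardPosition_appendDigit hx h', hn⟩
    by_cases hover : (boardGame A B).Over (boardPosition A B π)
    · refine .ended _ hover ?_
      by_cases ht : playerAfter π.length = p
      · obtain ⟨x, hl, -⟩ := main ht
        exact absurd (hover hl.1) hl.2.1
      · exact (Player.eq_other_of_ne (Ne.symm ht)).symm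
    by_cases ht : playerAfter π.length = p
    · have hex := main ht
      have hτ : cellStrategy A B p σ (boardPosition A B π) = hex.choose := dif_pos hex
      obtain ⟨hl, hr⟩ := hex.choose_spec
      rw [← hτ] at hl hr
      exact .own _ hover ht hl (step _ hl hr)
    · refine .opp _ hover ht fun x hl => step x hl ?_
      cases hw with
      | ended _ h => exact absurd h hπ.not_over
      | own _ _ h => exact absurd h ht
      | opp _ _ _ hn =>
        obtain ⟨m, hm, hx⟩ := hπ.exists_digit_of_legal hl
        have h' := (hπ.appendDigit_iff hm.1 hm.2 hx).2 hl.1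
        exact ⟨_, h', hπ.boardPosition_appendDigit hx h', hn m hm⟩

theorem avoidance_iff_board (A B : ℕ) (p : Player) :
    HasWinningStrategy (esGame .avoidance (A + 1) (B + 1)) p ↔
      HasWinningStrategy (boardGame A B) p := by
  constructor
  · rintro ⟨σ, hσ⟩
    exact ⟨_, winsFrom_board_of_represented _ rfl ⟨[], alive_nil A B, boardPosition_nil A B, hσ⟩⟩
  · rintro ⟨σ, hσ⟩
    exact ⟨_, winsFrom_avoidance_of_board hσ (alive_nil A B) (boardPosition_nil A B)⟩

theorem achievement_iff_avoidance {a b : ℕ} (ha : 1 ≤ a) (hb : 1 ≤ b) (p : Player) :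
    HasWinningStrategy (esGame .achievement (a + 1) (b + 1)) p ↔
      HasWinningStrategy (esGame .avoidance a b) p := by
  obtain ⟨h₁, h₂⟩ := achievement_reduction ha hb p
  exact ⟨fun ⟨σ, hσ⟩ => ⟨σ, h₁ σ hσ⟩, fun ⟨σ, hσ⟩ => (h₂ σ hσ).imp fun _ h => h.1⟩

theorem achievement_iff_board (A B : ℕ) (p : Player) :
    HasWinningStrategy (esGame .achievement (A + 2) (B + 2)) p ↔
      HasWinningStrategy (boardGame A B) p :=
  (achievement_iff_avoidance (by omega) (by omega) p).trans (avoidance_iff_board A B p)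

/-! ### The case b = 2, decided by the second move -/

theorem isWinningStrategy_achievement_two {a : ℕ} (ha : 2 ≤ a) {σ : List ℕ → ℕ} (hσ : σ [1] = 1) :
    IsWinningStrategy (esGame .achievement a 2) .second σ := by
  refine .opp _ (not_or.2 ⟨not_containsI_nil (by omega), not_containsJ_nil (by omega)⟩)
    (by simp [esGame, playerAfter]) ?_
  rintro m ⟨h₁, h₂⟩
  obtain rfl : m = 1 := le_antisymm h₂ h₁
  have h1 : (esGame .achievement a 2).next (esGame .achievement a 2).start 1 = [1] := rfl
  rw [h1]
  refine .own _ (not_or.2 ⟨?_, ?_⟩) (by simp [esGame, playerAfter])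
    (by rw [hσ]; simp [esGame]) ?_
  · rintro ⟨s, hs, hl, -⟩
    have := hs.length_le
    simp at this
    omega
  · rintro ⟨s, hs, hl, -⟩
    have := hs.length_le
    simp at this
    omega
  · rw [hσ]
    exact .ended _ (Or.inr ⟨[2, 1], by simp [esGame, appendDigit], rfl, by simp⟩)
      (by simp [esGame, appendDigit, playerAfter, Player.other])

/-! ### Strategies from closed sets of positions -/

/-- In the board game a player wins from a position in a set `T` with the opponent to move, if the
positions in `T` that are not final admit no immediate win and every move can be answered by a
return to `T`. -/
theorem exists_winsFrom_of_closed {A B : ℕ} (T : Set (Finset (ℕ × ℕ)))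
    (hT : ∀ s ∈ T, board A B ⊆ s ∨ ∀ q x, (boardGame A B).Legal (s, q) x →
      ¬ board A B ⊆ s ∪ board x.1 x.2 ∧ ∀ q', ∃ y,
        (boardGame A B).Legal (s ∪ board x.1 x.2, q') y ∧
          s ∪ board x.1 x.2 ∪ board y.1 y.2 ∈ T) :
    ∃ σ : Finset (ℕ × ℕ) × Player → ℕ × ℕ, σ (∅, .first) = (1, 1) ∧
      ∀ p, ∀ s ∈ T, WinsFrom (boardGame A B) p σ (s, p.other) := by
  classical
  -- The initial position is excluded so that `σ` opens with `(1, 1)`; any other position is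
  -- answered by a return to `T` if there is one, whoever is to move.
  let σ : Finset (ℕ × ℕ) × Player → ℕ × ℕ := fun s =>
    if h : ∃ y, s ≠ (∅, .first) ∧ (boardGame A B).Legal s y ∧ s.1 ∪ board y.1 y.2 ∈ T
      then h.choose else (1, 1)
  refine ⟨σ, dif_neg (by simp), fun p s hs => ?_⟩
  induction hn : (board A B \ s).card using Nat.strong_induction_on generalizing s with
  | _ n ih =>
    subst hn
    rcases hT s hs with hfull | hmove
    · exact .ended _ hfull p.other_other
    by_cases hover : board A B ⊆ s
    · exact .ended _ hover p.other_other
    refine .opp _ hover p.other_ne fun x hx => ?_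
    obtain ⟨hx', hy⟩ := hmove _ x hx
    have hnext : (boardGame A B).next (s, p.other) x = (s ∪ board x.1 x.2, p) := by
      simp [boardGame, Player.other_other]
    have hlt := card_sdiff_next_lt hx
    rw [hnext] at hlt ⊢
    have hne : (s ∪ board x.1 x.2, p) ≠ (∅, Player.first) := by
      intro h
      have hb := mem_board.1 hx.1
      have : x ∈ s ∪ board x.1 x.2 :=
        Finset.mem_union_right _ (mem_board.2 ⟨⟨hb.1.1, le_rfl⟩, hb.2.1, le_rfl⟩)
      rw [(Prod.mk.inj h).1] at this
      simp at this
    have hex : ∃ y, (s ∪ board x.1 x.2, p) ≠ (∅, Player.first) ∧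
        (boardGame A B).Legal (s ∪ board x.1 x.2, p) y ∧
        (s ∪ board x.1 x.2, p).1 ∪ board y.1 y.2 ∈ T :=
      (hy p).imp fun y h => ⟨hne, h⟩
    have hσ : σ (s ∪ board x.1 x.2, p) = hex.choose := dif_pos hex
    obtain ⟨-, hl, hmem⟩ := hex.choose_spec
    rw [← hσ] at hl hmem
    exact .own _ hx' rfl hl (ih _ ((card_sdiff_next_lt hl).trans hlt) _ hmem rfl)

theorem board_first_legal {A B : ℕ} (hA : 1 ≤ A) (hB : 1 ≤ B) (x : ℕ × ℕ) :
    (boardGame A B).Legal (∅, .first) x ↔ x = (1, 1) := by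
  simp only [boardGame, mem_board]
  constructor
  · rintro ⟨-, -, ⟨-, rfl⟩ | ⟨y, hy, -⟩⟩
    · rfl
    · simp at hy
  · rintro rfl
    simp [hA, hB]

theorem not_board_subset_empty {A B : ℕ} (hA : 1 ≤ A) (hB : 1 ≤ B) : ¬ board A B ⊆ ∅ := by
  intro h
  have := h (mem_board (x := (1, 1)) |>.2 ⟨⟨le_rfl, hA⟩, le_rfl, hB⟩)
  simp at this

/-! ### Regions with at most four rows and their moves -/

/-- The lengths of the first four rows of a shaded region, as a function of the row. -/
def rows (a b c d : ℕ) : ℕ → ℕ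
  | 1 => a
  | 2 => b
  | 3 => c
  | 4 => d
  | _ => 0

/-- The region with at most four rows of the lengths `a`, `b`, `c`, `d`. -/
def region (a b c d : ℕ) : Finset (ℕ × ℕ) :=
  (board a 4).filter fun x => x.1 ≤ rows a b c d x.2

/-- The row lengths of a region that is contained in the board with `A` columns and `B ≤ 4` rows. -/
structure IsRegion (A B a b c d : ℕ) : Prop where
  ha : 1 ≤ a
  hA : a ≤ A
  hab : b ≤ a
  hbc : c ≤ b
  hcd : d ≤ c
  hc : B ≤ 2 → c = 0
  hd : B ≤ 3 → d = 0

theorem mem_region {A B a b c d : ℕ} (h : IsRegion A B a b c d) {x : ℕ × ℕ} :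
    x ∈ region a b c d ↔ 1 ≤ x.1 ∧ 1 ≤ x.2 ∧ x.1 ≤ rows a b c d x.2 := by
  obtain ⟨x₁, x₂⟩ := x
  obtain ⟨ha, -, hab, hbc, hcd, -, -⟩ := h
  simp only [region, Finset.mem_filter, mem_board]
  constructor
  · tauto
  · rintro ⟨h₁, h₂, h₃⟩
    match x₂, h₂, h₃ with
    | 1, _, h => simp only [rows] at h ⊢; omega
    | 2, _, h => simp only [rows] at h ⊢; omega
    | 3, _, h => simp only [rows] at h ⊢; omega
    | 4, _, h => simp only [rows] at h ⊢; omega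
    | n + 5, _, h => simp only [rows] at h; omega

/-- On the board with `A` columns and `B ≤ 4` rows, the shaded region with row lengths `a`, `b`, `c`,
`d` may be turned into the one with row lengths `a'`, `b'`, `c'`, `d'` by claiming a cell. -/
inductive Move (A B a b c d : ℕ) : ℕ → ℕ → ℕ → ℕ → Prop
  | row_one (hA : a < A) : Move A B a b c d (a + 1) b c d
  -- A cell in a lower row is reached from the row above (`x ≤ a`) or from the end of its own
  -- nonempty row (`x = b + 1`). In the latter case it may stick out beyond the row above, hence the
  -- maximum.
  | row_two {x : ℕ} (hB : 2 ≤ B) (hA : x ≤ A) (hx : b < x) (h : x ≤ a ∨ 1 ≤ b ∧ x = b + 1) :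
      Move A B a b c d (max a x) x c d
  | row_three {x : ℕ} (hB : 3 ≤ B) (hA : x ≤ A) (hx : c < x) (h : x ≤ b ∨ 1 ≤ c ∧ x = c + 1) :
      Move A B a b c d (max a x) (max b x) x d
  | row_four {x : ℕ} (hB : 4 ≤ B) (hA : x ≤ A) (hx : d < x) (h : x ≤ c ∨ 1 ≤ d ∧ x = d + 1) :
      Move A B a b c d (max a x) (max b x) (max c x) x

theorem IsRegion.move {A B a b c d a' b' c' d' : ℕ} (h : IsRegion A B a b c d)
    (hm : Move A B a b c d a' b' c' d') : IsRegion A B a' b' c' d' := by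
  obtain ⟨ha, hA, hab, hbc, hcd, hc, hd⟩ := h
  cases hm <;> constructor <;> omega

theorem region_union_board {A B a b c d a' b' c' d' x r : ℕ} (h : IsRegion A B a b c d)
    (h' : IsRegion A B a' b' c' d')
    (h₁ : a' = if 1 ≤ r then max a x else a) (h₂ : b' = if 2 ≤ r then max b x else b)
    (h₃ : c' = if 3 ≤ r then max c x else c) (h₄ : d' = if 4 ≤ r then max d x else d)
    (hr : r ≤ 4) : region a b c d ∪ board x r = region a' b' c' d' := by
  ext ⟨y₁, y₂⟩
  rw [Finset.mem_union, mem_region h, mem_region h', mem_board]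
  subst h₁ h₂ h₃ h₄
  match y₂ with
  | 0 => simp
  | 1 | 2 | 3 | 4 => simp only [rows]; split_ifs <;> omega
  | n + 5 => simp only [rows]; omega

theorem region_adjacent {A B a b c d x r : ℕ} (h : IsRegion A B a b c d) (hx : 1 ≤ x) (hr : 1 ≤ r)
    (hn : (x, r) ∉ region a b c d) :
    (∃ y ∈ region a b c d, EdgeAdjacent y (x, r)) ↔
      (2 ≤ r ∧ x ≤ rows a b c d (r - 1)) ∨ (1 ≤ rows a b c d r ∧ x = rows a b c d r + 1) := by
  rw [mem_region h] at hn
  simp only [hx, hr, true_and, not_le] at hn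
  constructor
  · rintro ⟨⟨y₁, y₂⟩, hy, hadj⟩
    rw [mem_region h] at hy
    simp only [EdgeAdjacent] at hy hadj
    rcases hadj with ⟨rfl, rfl | rfl⟩ | ⟨rfl, rfl | rfl⟩
    · left
      simpa using hy.2
    · exfalso
      have : rows a b c d (r + 1) ≤ rows a b c d r := by
        obtain ⟨-, -, hab, hbc, hcd, -, -⟩ := h
        match r with
        | 0 => omega
        | 1 | 2 | 3 => assumption
        | 4 => exact Nat.zero_le _
        | n + 5 => exact Nat.zero_le _
      omega
    · right
      omega
    · omega
  · rintro (⟨h₁, h₂⟩ | ⟨h₁, h₂⟩)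
    · refine ⟨(x, r - 1), (mem_region h).2 ⟨hx, by simp only; omega, h₂⟩, Or.inl ⟨rfl, Or.inl ?_⟩⟩
      simp only
      omega
    · exact ⟨(rows a b c d r, r), (mem_region h).2 ⟨h₁, hr, le_rfl⟩, Or.inr ⟨rfl, Or.inl h₂.symm⟩⟩

theorem region_ne_empty {A B a b c d : ℕ} (h : IsRegion A B a b c d) : region a b c d ≠ ∅ :=
  Finset.nonempty_iff_ne_empty.1 ⟨(1, 1), (mem_region h).2 ⟨le_rfl, le_rfl, h.ha⟩⟩

theorem region_legal_iff {A B a b c d x r : ℕ} (h : IsRegion A B a b c d) (q : Player) :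
    (boardGame A B).Legal (region a b c d, q) (x, r) ↔
      (x ≤ A ∧ 1 ≤ r ∧ r ≤ B) ∧ rows a b c d r < x ∧
      ((2 ≤ r ∧ x ≤ rows a b c d (r - 1)) ∨ (1 ≤ rows a b c d r ∧ x = rows a b c d r + 1)) := by
  simp only [boardGame, region_ne_empty h, false_and, false_or]
  constructor
  · rintro ⟨h₁, h₂, h₃⟩
    obtain ⟨⟨h₄, h₅⟩, h₆, h₇⟩ := mem_board.1 h₁
    refine ⟨⟨h₅, h₆, h₇⟩, ?_, (region_adjacent h h₄ h₆ h₂).1 h₃⟩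
    rw [mem_region h] at h₂
    simpa [h₄, h₆] using h₂
  · rintro ⟨⟨h₁, h₂, h₃⟩, h₄, h₅⟩
    have hx : 1 ≤ x := by omega
    have hn : (x, r) ∉ region a b c d := fun hc => by
      have := ((mem_region h).1 hc).2.2
      simp only at this
      omega
    exact ⟨mem_board.2 ⟨⟨hx, h₁⟩, h₂, h₃⟩, hn, (region_adjacent h hx h₂ hn).2 h₅⟩

theorem exists_move_of_legal {A B a b c d : ℕ} (hB : B ≤ 4) (h : IsRegion A B a b c d) {q : Player}
    {x : ℕ × ℕ} (hx : (boardGame A B).Legal (region a b c d, q) x) :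
    ∃ a' b' c' d', Move A B a b c d a' b' c' d' ∧
      region a b c d ∪ board x.1 x.2 = region a' b' c' d' := by
  obtain ⟨x, r⟩ := x
  obtain ⟨⟨h₁, h₂, h₃⟩, h₄, h₅⟩ := (region_legal_iff h q).1 hx
  obtain ⟨ha, hA, hab, hbc, hcd, hc, hd⟩ := id h
  match r with
  | 0 => omega
  | 1 =>
    simp only [rows] at h₄ h₅
    have hm : Move A B a b c d (a + 1) b c d := .row_one (by omega)
    refine ⟨_, _, _, _, hm, region_union_board h (h.move hm) ?_ ?_ ?_ ?_ (by simp)⟩ <;>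
      simp only <;> split_ifs <;> omega
  | 2 =>
    simp only [rows] at h₄ h₅
    have hm : Move A B a b c d (max a x) x c d := .row_two h₃ h₁ h₄ (by omega)
    refine ⟨_, _, _, _, hm, region_union_board h (h.move hm) ?_ ?_ ?_ ?_ (by simp)⟩ <;>
      simp only <;> split_ifs <;> omega
  | 3 =>
    simp only [rows] at h₄ h₅
    have hm : Move A B a b c d (max a x) (max b x) x d := .row_three h₃ h₁ h₄ (by omega)
    refine ⟨_, _, _, _, hm, region_union_board h (h.move hm) ?_ ?_ ?_ ?_ (by simp)⟩ <;>
      simp only <;> split_ifs <;> omega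
  | 4 =>
    simp only [rows] at h₄ h₅
    have hm : Move A B a b c d (max a x) (max b x) (max c x) x := .row_four h₃ h₁ h₄ (by omega)
    refine ⟨_, _, _, _, hm, region_union_board h (h.move hm) ?_ ?_ ?_ ?_ (by simp)⟩ <;>
      simp only <;> split_ifs <;> omega
  | n + 5 => omega

theorem exists_legal_of_move {A B a b c d a' b' c' d' : ℕ} (hB : 1 ≤ B)
    (h : IsRegion A B a b c d) (hm : Move A B a b c d a' b' c' d') (q : Player) :
    ∃ x, (boardGame A B).Legal (region a b c d, q) x ∧
      region a b c d ∪ board x.1 x.2 = region a' b' c' d' := by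
  have h' := h.move hm
  obtain ⟨ha, hA, hab, hbc, hcd, hc, hd⟩ := id h
  cases hm with
  | row_one h₁ =>
    refine ⟨(a + 1, 1), (region_legal_iff h q).2 ?_, region_union_board h h' ?_ ?_ ?_ ?_ (by simp)⟩
    · exact ⟨⟨h₁, le_rfl, hB⟩, Nat.lt_succ_self a, Or.inr ⟨ha, rfl⟩⟩
    all_goals simp only; split_ifs <;> omega
  | row_two h₁ h₂ h₃ h₄ =>
    refine ⟨(b', 2), (region_legal_iff h q).2 ?_, region_union_board h h' ?_ ?_ ?_ ?_ (by simp)⟩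
    · simp only [rows]; omega
    all_goals simp only; split_ifs <;> omega
  | row_three h₁ h₂ h₃ h₄ =>
    refine ⟨(c', 3), (region_legal_iff h q).2 ?_, region_union_board h h' ?_ ?_ ?_ ?_ (by simp)⟩
    · simp only [rows]; omega
    all_goals simp only; split_ifs <;> omega
  | row_four h₁ h₂ h₃ h₄ =>
    refine ⟨(d', 4), (region_legal_iff h q).2 ?_, region_union_board h h' ?_ ?_ ?_ ?_ (by simp)⟩
    · simp only [rows]; omega
    all_goals simp only; split_ifs <;> omega

/-- Row lengths decrease weakly, so the last row decides. -/
theorem board_subset_region_iff {A B a b c d : ℕ} (hB : 1 ≤ B) (hB' : B ≤ 4)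
    (h : IsRegion A B a b c d) : board A B ⊆ region a b c d ↔ A ≤ rows a b c d B := by
  obtain ⟨ha, hA, hab, hbc, hcd, -, -⟩ := id h
  constructor
  · intro hs
    exact ((mem_region h).1 (hs (mem_board.2 ⟨⟨ha.trans hA, le_rfl⟩, hB, le_rfl⟩ :
      (A, B) ∈ board A B))).2.2
  · rintro hA ⟨x₁, x₂⟩ hx
    rw [mem_board] at hx
    refine (mem_region h).2 ⟨hx.1.1, hx.2.1, hx.1.2.trans (hA.trans ?_)⟩
    obtain ⟨-, h₁, h₂⟩ := hx
    simp only at h₁ h₂ ⊢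
    interval_cases B <;> interval_cases x₂ <;> simp only [rows] <;> omega

/-- The first player wins the board game if there is a set `T` of regions that contains the region
after the first move, admits no immediate win, and can be returned to after every move. -/
theorem board_first_wins_of_closed {A B : ℕ} (hA : 1 ≤ A) (hB : 1 ≤ B) (hB' : B ≤ 4)
    (T : ℕ → ℕ → ℕ → ℕ → Prop) (hT : ∀ {a b c d}, T a b c d → IsRegion A B a b c d)
    (h₀ : T 1 0 0 0)
    (hclosed : ∀ {a b c d}, T a b c d → A ≤ rows a b c d B ∨
      ∀ {a' b' c' d'}, Move A B a b c d a' b' c' d' → rows a' b' c' d' B < A ∧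
        ∃ a'' b'' c'' d'', Move A B a' b' c' d' a'' b'' c'' d'' ∧ T a'' b'' c'' d'') :
    HasWinningStrategy (boardGame A B) .first := by
  obtain ⟨σ, hσ, hw⟩ := exists_winsFrom_of_closed (A := A) (B := B)
    {s | ∃ a b c d, T a b c d ∧ s = region a b c d} (by
      rintro _ ⟨a, b, c, d, ht, rfl⟩
      rw [board_subset_region_iff hB hB' (hT ht)]
      refine (hclosed ht).imp_right fun hmove q x hx => ?_
      obtain ⟨a', b', c', d', hm, hu⟩ := exists_move_of_legal hB' (hT ht) hx
      have h' := (hT ht).move hm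
      obtain ⟨hlt, a'', b'', c'', d'', hm', ht'⟩ := hmove hm
      rw [hu, board_subset_region_iff hB hB' h']
      refine ⟨hlt.not_ge, fun q' => ?_⟩
      obtain ⟨y, hy, hu'⟩ := exists_legal_of_move hB h' hm' q'
      exact ⟨y, hy, _, _, _, _, ht', hu'⟩)
  refine ⟨σ, .own _ (not_board_subset_empty hA hB) rfl ?_ ?_⟩
  · change (boardGame A B).Legal (∅, .first) (σ (∅, .first))
    rw [hσ]
    exact (board_first_legal hA hB _).2 rfl
  · have : (boardGame A B).next (boardGame A B).start (σ (boardGame A B).start) =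
        (region 1 0 0 0, Player.first.other) := by
      change (∅ ∪ board (σ (∅, .first)).1 (σ (∅, .first)).2, _) = _
      rw [hσ]
      rfl
    rw [this]
    exact hw _ _ ⟨_, _, _, _, h₀, rfl⟩

/-! ### Boards with one row -/

theorem board_one_row (A : ℕ) : ∃ σ : Finset (ℕ × ℕ) × Player → ℕ × ℕ, σ (∅, .first) = (1, 1) ∧
    ∀ p, ∀ k ≤ A, Even (A - k) → WinsFrom (boardGame A 1) p σ (board k 1, p.other) := by
  have hlegal : ∀ k q x, (boardGame A 1).Legal (board k 1, q) x ↔ k < A ∧ x = (k + 1, 1) := by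
    rintro k q ⟨x₁, x₂⟩
    simp only [boardGame, mem_board]
    constructor
    · rintro ⟨h₁, h₂, ⟨h₃, h₄⟩ | ⟨⟨y₁, y₂⟩, hy, hadj⟩⟩
      · obtain ⟨rfl, rfl⟩ := Prod.mk.inj h₄
        have hk : k = 0 := by
          by_contra hk
          have : (1, 1) ∈ board k 1 := mem_board.2 ⟨⟨le_rfl, by simp only; omega⟩, le_rfl, le_rfl⟩
          simp [h₃] at this
        subst hk
        exact ⟨by omega, rfl⟩
      · simp only [EdgeAdjacent] at hadj hy
        obtain ⟨rfl, rfl⟩ : x₁ = k + 1 ∧ x₂ = 1 := by omega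
        exact ⟨by omega, rfl⟩
    · rintro ⟨hk, h⟩
      obtain ⟨rfl, rfl⟩ := Prod.mk.inj h
      refine ⟨by omega, by omega, ?_⟩
      rcases Nat.eq_zero_or_pos k with rfl | hk
      · exact Or.inl ⟨rfl, rfl⟩
      · exact Or.inr ⟨(k, 1), ⟨⟨hk, le_rfl⟩, le_rfl, le_rfl⟩, Or.inr ⟨rfl, Or.inl rfl⟩⟩
  have hnext : ∀ k, board k 1 ∪ board (k + 1) 1 = board (k + 1) 1 := fun k => by
    ext x
    simp only [Finset.mem_union, mem_board]
    omega
  have hfull : ∀ k, 1 ≤ A → (board A 1 ⊆ board k 1 ↔ A ≤ k) := by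
    refine fun k hA => ⟨fun h => ?_, fun h x hx => ?_⟩
    · exact (mem_board.1 (h (mem_board.2 ⟨⟨hA, le_rfl⟩, le_rfl, le_rfl⟩ : (A, 1) ∈ _))).1.2
    · rw [mem_board] at hx ⊢
      omega
  -- Each move shades exactly the next cell, so two moves keep the number of open cells even. The
  -- value `k = 0` is the empty board, from which the second player's strategy starts.
  obtain ⟨σ, hσ, hw⟩ := exists_winsFrom_of_closed (A := A) (B := 1)
    {s | ∃ k ≤ A, Even (A - k) ∧ s = board k 1} (by
      rintro _ ⟨k, hk, heven, rfl⟩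
      rcases hk.eq_or_lt with rfl | hlt
      · exact Or.inl le_rfl
      refine Or.inr fun q x hx => ?_
      obtain ⟨-, rfl⟩ := (hlegal k q x).1 hx
      obtain ⟨j, hj⟩ := heven
      simp only [hnext]
      rw [hfull _ (by omega)]
      refine ⟨by omega, fun q' => ⟨(k + 2, 1), (hlegal _ _ _).2 ⟨by omega, rfl⟩, k + 2, by omega,
        ⟨j - 1, by omega⟩, hnext (k + 1)⟩⟩)
  exact ⟨σ, hσ, fun p k hk he => hw p _ ⟨k, hk, he, rfl⟩⟩

theorem board_one_row_first {A : ℕ} (hA : Odd A) : HasWinningStrategy (boardGame A 1) .first := by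
  obtain ⟨σ, hσ, hw⟩ := board_one_row A
  obtain ⟨k, rfl⟩ := hA
  refine ⟨σ, .own _ (not_board_subset_empty (by omega) le_rfl) rfl ?_ ?_⟩
  · change (boardGame _ 1).Legal (∅, .first) (σ (∅, .first))
    rw [hσ]
    exact (board_first_legal (by omega) le_rfl _).2 rfl
  · have : (boardGame (2 * k + 1) 1).next (boardGame (2 * k + 1) 1).start
        (σ (boardGame (2 * k + 1) 1).start) = (board 1 1, Player.first.other) := by
      change (∅ ∪ board (σ (∅, .first)).1 (σ (∅, .first)).2, _) = _
      rw [hσ]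
      rfl
    rw [this]
    exact hw _ 1 (by omega) (by simp)

theorem board_one_row_second {A : ℕ} (hA : Even A) :
    HasWinningStrategy (boardGame A 1) .second := by
  obtain ⟨σ, -, hw⟩ := board_one_row A
  exact ⟨σ, hw .second 0 (Nat.zero_le _) (by simpa using hA)⟩

/-! ### Boards with two and three rows -/

/-- In the region with row lengths `a`, `b`, `c`, `d` there is a move to a region in `T`. -/
def HasReply (A B : ℕ) (T : ℕ → ℕ → ℕ → ℕ → Prop) (a b c d : ℕ) : Prop :=
  ∃ a' b' c' d', Move A B a b c d a' b' c' d' ∧ T a' b' c' d'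

namespace HasReply

variable {A B a b c d : ℕ} {T : ℕ → ℕ → ℕ → ℕ → Prop}

theorem row_one (h : a < A) (hT : T (a + 1) b c d) : HasReply A B T a b c d :=
  ⟨_, _, _, _, .row_one h, hT⟩

theorem row_two (x : ℕ) (h : 2 ≤ B ∧ x ≤ A ∧ b < x ∧ (x ≤ a ∨ 1 ≤ b ∧ x = b + 1))
    (hT : T (max a x) x c d) : HasReply A B T a b c d :=
  ⟨_, _, _, _, .row_two h.1 h.2.1 h.2.2.1 h.2.2.2, hT⟩

theorem row_three (x : ℕ) (h : 3 ≤ B ∧ x ≤ A ∧ c < x ∧ (x ≤ b ∨ 1 ≤ c ∧ x = c + 1))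
    (hT : T (max a x) (max b x) x d) : HasReply A B T a b c d :=
  ⟨_, _, _, _, .row_three h.1 h.2.1 h.2.2.1 h.2.2.2, hT⟩

theorem row_four (x : ℕ) (h : 4 ≤ B ∧ x ≤ A ∧ d < x ∧ (x ≤ c ∨ 1 ≤ d ∧ x = d + 1))
    (hT : T (max a x) (max b x) (max c x) x) : HasReply A B T a b c d :=
  ⟨_, _, _, _, .row_four h.1 h.2.1 h.2.2.1 h.2.2.2, hT⟩

end HasReply

/-- Regions to which the first player can always return on a board with two rows. -/
inductive TwoRows (A a b c d : ℕ) : Prop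
  | full (h : a = A ∧ b = A ∧ c = 0 ∧ d = 0)
  | step (h : a < A ∧ a = b + 1 ∧ c = 0 ∧ d = 0)

/-- A lead of one cell in the first row is restored after every move until the opponent shades a
cell of the last column, when the corner can be claimed. -/
theorem board_two_rows {A : ℕ} (hA : 2 ≤ A) : HasWinningStrategy (boardGame A 2) .first := by
  refine board_first_wins_of_closed (by omega) (by omega) (by omega) (TwoRows A) ?_
    (.step (by omega)) ?_
  · rintro a b c d (h | h) <;> constructor <;> omega
  rintro a b c d (h | h)
  · left; simp only [rows]; omega
  refine Or.inr fun {a' b' c' d'} hm => ⟨by cases hm <;> simp only [rows] <;> omega, ?_⟩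
  change HasReply A 2 (TwoRows A) _ _ _ _
  cases hm with
  | row_one h₁ =>
    by_cases hA : a + 1 < A
    · exact .row_two a (by omega) (.step (by omega))
    · exact .row_two A (by omega) (.full (by omega))
  | row_two _ h₁ h₂ h₃ =>
    by_cases hA : a + 1 < A
    · exact .row_one (by omega) (.step (by omega))
    · exact .row_two A (by omega) (.full (by omega))
  | row_three h₁ => omega
  | row_four h₁ => omega

/-- Regions to which the first player can always return on a board with three rows. -/
inductive ThreeRows (A a b c d : ℕ) : Prop
  | full (h : a = A ∧ b = A ∧ c = A ∧ d = 0)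
  | top (h : a = A ∧ b < A ∧ b = c + 1 ∧ d = 0)
  | hook (h : a < A ∧ a = b + 1 ∧ b = c ∧ d = 0)
  | block (h : a < A ∧ a = b ∧ b = c + 2 ∧ d = 0)

/-- From `hook` or `block`, a move and its reply together lengthen the first row by one and lead to
one of these types again, until the first row is full. In `top` the two-row strategy is played in
rows two and three. -/
theorem board_three_rows {A : ℕ} (hA : 3 ≤ A) : HasWinningStrategy (boardGame A 3) .first := by
  refine board_first_wins_of_closed (by omega) (by omega) (by omega) (ThreeRows A) ?_
    (.hook (by omega)) ?_
  · rintro a b c d (h | h | h | h) <;> constructor <;> omega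
  rintro a b c d (h | h | h | h)
  · left; simp only [rows]; omega
  all_goals
    refine Or.inr fun {a' b' c' d'} hm => ⟨by cases hm <;> simp only [rows] <;> omega, ?_⟩
    change HasReply A 3 (ThreeRows A) _ _ _ _
  · cases hm with
    | row_one h₁ => omega
    | row_two _ h₁ h₂ h₃ =>
      by_cases hA : b' < A
      · exact .row_three (b' - 1) (by omega) (.top (by omega))
      · exact .row_three A (by omega) (.full (by omega))
    | row_three _ h₁ h₂ h₃ =>
      by_cases hA : b + 1 < A
      · exact .row_two (b + 1) (by omega) (.top (by omega))
      · exact .row_three A (by omega) (.full (by omega))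
    | row_four h₁ => omega
  · cases hm with
    | row_one h₁ =>
      by_cases hA : a + 1 < A
      -- If the lower rows are empty, row three cannot be entered; the reply is then the block with
      -- row lengths 2, 2, 0.
      · by_cases hc : 1 ≤ c
        · exact .row_three (c + 1) (by omega) (.hook (by omega))
        · exact .row_two 2 (by omega) (.block (by omega))
      · exact .row_two a (by omega) (.top (by omega))
    | row_two _ h₁ h₂ h₃ =>
      by_cases hA : a + 1 < A
      · exact .row_two (a + 1) (by omega) (.block (by omega))
      · exact .row_one (by omega) (.top (by omega))
    | row_three _ h₁ h₂ h₃ =>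
      by_cases hA : a + 1 < A
      · exact .row_one (by omega) (.hook (by omega))
      · exact .row_three A (by omega) (.full (by omega))
    | row_four h₁ => omega
  · cases hm with
    | row_one h₁ =>
      by_cases hA : a + 1 < A
      · exact .row_three b (by omega) (.hook (by omega))
      · exact .row_three (b - 1) (by omega) (.top (by omega))
    | row_two _ h₁ h₂ h₃ =>
      by_cases hA : a + 1 < A
      · exact .row_three (b - 1) (by omega) (.block (by omega))
      · exact .row_three A (by omega) (.full (by omega))
    | row_three _ h₁ h₂ h₃ =>
      by_cases hc : c' = c + 1
      · by_cases hA : a + 1 < A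
        · exact .row_two (a + 1) (by omega) (.block (by omega))
        · exact .row_one (by omega) (.top (by omega))
      · by_cases hA : a + 1 < A
        · exact .row_one (by omega) (.hook (by omega))
        · exact .row_three A (by omega) (.full (by omega))
    | row_four h₁ => omega

/-! ### Boards with four rows -/

/-- Regions to which the first player can always return on a board with four rows. The digits in a
name are the differences of the lengths of consecutive rows, `k` being arbitrary; `top` means that
the first row is full, `odd` and `even` refer to the number of cells missing in the first row. -/
inductive FourRows (A a b c d : ℕ) : Prop
  | full (h : a = A ∧ b = A ∧ c = A ∧ d = A)
  | start (h : a = 1 ∧ b = 0 ∧ c = 0 ∧ d = 0)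
  | top_0k1 (h : a = A ∧ b = A ∧ c < A ∧ c = d + 1)
  | top_102 (h : a = A ∧ a = b + 1 ∧ b = c ∧ c = d + 2)
  | top_110 (h : a = A ∧ a = b + 1 ∧ b = c + 1 ∧ c = d)
  | odd_003 (h : a < A ∧ (A - a) % 2 = 1 ∧ a = b ∧ b = c ∧ c = d + 3)
  | odd_100 (h : a < A ∧ (A - a) % 2 = 1 ∧ a = b + 1 ∧ b = c ∧ c = d)
  | even_001 (h : a < A ∧ (A - a) % 2 = 0 ∧ a = b ∧ b = c ∧ c = d + 1)
  | even_012 (h : a < A ∧ (A - a) % 2 = 0 ∧ a = b ∧ b = c + 1 ∧ c = d + 2)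
  | even_101 (h : a < A ∧ (A - a) % 2 = 0 ∧ a = b + 1 ∧ b = c ∧ c = d + 1)
  | all_020 (h : a < A ∧ a = b ∧ b = c + 2 ∧ c = d)
  | all_1k1 (h : a < A ∧ a = b + 1 ∧ c < b ∧ c = d + 1)

namespace FourRows

variable {A a b c d a' b' c' d' : ℕ}

theorem isRegion (hA : 4 ≤ A) (h : FourRows A a b c d) : IsRegion A 4 a b c d := by
  cases h <;> constructor <;> omega

/-- Every type other than `full` has `c < A` and `d + 1 < A`, so the corner is out of reach in one
move. -/
theorem not_full_of_move (hA : 4 ≤ A) (h : FourRows A a b c d) (hd : d < A)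
    (hm : Move A 4 a b c d a' b' c' d') : d' < A := by
  cases hm with
  | row_four => cases h <;> omega
  | _ => exact hd

theorem reply_start (hA : 4 ≤ A) (hm : Move A 4 a b c d a' b' c' d')
    (h : a = 1 ∧ b = 0 ∧ c = 0 ∧ d = 0) : HasReply A 4 (FourRows A) a' b' c' d' := by
  cases hm with
  | row_one h₁ => exact .row_two 2 (by omega) (.all_020 (by omega))
  | row_two _ h₁ h₂ h₃ => exact .row_two 2 (by omega) (.all_020 (by omega))
  | row_three => omega
  | row_four => omega

/-- With the first two rows full, this is the two-row strategy in rows three and four. -/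
theorem reply_top_0k1 (hm : Move A 4 a b c d a' b' c' d')
    (h : a = A ∧ b = A ∧ c < A ∧ c = d + 1) : HasReply A 4 (FourRows A) a' b' c' d' := by
  cases hm with
  | row_one => omega
  | row_two => omega
  | row_three _ h₁ h₂ h₃ =>
    by_cases hA : c' < A
    · exact .row_four (c' - 1) (by omega) (.top_0k1 (by omega))
    · exact .row_four A (by omega) (.full (by omega))
  | row_four _ h₁ h₂ h₃ =>
    by_cases hA : c + 1 < A
    · exact .row_three (c + 1) (by omega) (.top_0k1 (by omega))
    · exact .row_four A (by omega) (.full (by omega))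

theorem reply_top_102 (hm : Move A 4 a b c d a' b' c' d')
    (h : a = A ∧ a = b + 1 ∧ b = c ∧ c = d + 2) : HasReply A 4 (FourRows A) a' b' c' d' := by
  cases hm with
  | row_one => omega
  | row_two _ h₁ h₂ h₃ => exact .row_four (d + 1) (by omega) (.top_0k1 (by omega))
  | row_three _ h₁ h₂ h₃ => exact .row_four A (by omega) (.full (by omega))
  | row_four _ h₁ h₂ h₃ =>
    by_cases hd : d' = d + 1
    · exact .row_two A (by omega) (.top_0k1 (by omega))
    · exact .row_four A (by omega) (.full (by omega))

theorem reply_top_110 (hA : 4 ≤ A) (hm : Move A 4 a b c d a' b' c' d')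
    (h : a = A ∧ a = b + 1 ∧ b = c + 1 ∧ c = d) : HasReply A 4 (FourRows A) a' b' c' d' := by
  cases hm with
  | row_one => omega
  | row_two _ h₁ h₂ h₃ => exact .row_three (c + 1) (by omega) (.top_0k1 (by omega))
  | row_three _ h₁ h₂ h₃ => exact .row_two A (by omega) (.top_0k1 (by omega))
  | row_four _ h₁ h₂ h₃ => exact .row_four A (by omega) (.full (by omega))

/-- Moves are paired, each answering the other: away from the last column, rows one, two and three
pair with lengthening row four by two, one and three. If `a + 1 = A`, rows one and two exchange
partners, and a move in row three or one of three cells in row four is answered by the corner. -/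
theorem reply_odd_003 (hm : Move A 4 a b c d a' b' c' d')
    (h : a < A ∧ (A - a) % 2 = 1 ∧ a = b ∧ b = c ∧ c = d + 3) :
    HasReply A 4 (FourRows A) a' b' c' d' := by
  cases hm with
  | row_one h₁ =>
    by_cases hA : a + 1 < A
    · exact .row_four (d + 2) (by omega) (.even_101 (by omega))
    · exact .row_four (d + 1) (by omega) (.top_102 (by omega))
  | row_two _ h₁ h₂ h₃ =>
    by_cases hA : a + 1 < A
    · exact .row_four (d + 1) (by omega) (.even_012 (by omega))
    · exact .row_four (d + 2) (by omega) (.top_0k1 (by omega))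
  | row_three _ h₁ h₂ h₃ =>
    by_cases hA : a + 1 < A
    · exact .row_four a (by omega) (.even_001 (by omega))
    · exact .row_four A (by omega) (.full (by omega))
  | row_four _ h₁ h₂ h₃ =>
    obtain hd | hd | hd : d' = d + 1 ∨ d' = d + 2 ∨ d' = d + 3 := by omega
    · by_cases hA : a + 1 < A
      · exact .row_two (a + 1) (by omega) (.even_012 (by omega))
      · exact .row_one (by omega) (.top_102 (by omega))
    · by_cases hA : a + 1 < A
      · exact .row_one (by omega) (.even_101 (by omega))
      · exact .row_two A (by omega) (.top_0k1 (by omega))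
    · by_cases hA : a + 1 < A
      · exact .row_three (a + 1) (by omega) (.even_001 (by omega))
      · exact .row_four A (by omega) (.full (by omega))

theorem reply_odd_100 (hA : 4 ≤ A) (hm : Move A 4 a b c d a' b' c' d')
    (h : a < A ∧ (A - a) % 2 = 1 ∧ a = b + 1 ∧ b = c ∧ c = d) :
    HasReply A 4 (FourRows A) a' b' c' d' := by
  cases hm with
  | row_one h₁ =>
    by_cases hA : a + 1 < A
    · exact .row_two (a + 1) (by omega) (.all_020 (by omega))
    · exact .row_two a (by omega) (.top_110 (by omega))
  | row_two _ h₁ h₂ h₃ =>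
    by_cases hA : a + 1 < A
    · exact .row_two (a + 1) (by omega) (.all_020 (by omega))
    · exact .row_one (by omega) (.top_110 (by omega))
  | row_three _ h₁ h₂ h₃ =>
    by_cases hA : a + 1 < A
    · exact .row_one (by omega) (.even_101 (by omega))
    · exact .row_two A (by omega) (.top_0k1 (by omega))
  | row_four _ h₁ h₂ h₃ =>
    by_cases hA : a + 1 < A
    · exact .row_three (a + 1) (by omega) (.even_001 (by omega))
    · exact .row_four A (by omega) (.full (by omega))

theorem reply_even_001 (hm : Move A 4 a b c d a' b' c' d')
    (h : a < A ∧ (A - a) % 2 = 0 ∧ a = b ∧ b = c ∧ c = d + 1) :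
    HasReply A 4 (FourRows A) a' b' c' d' := by
  cases hm with
  | row_one h₁ => exact .row_four (d + 1) (by omega) (.odd_100 (by omega))
  | row_two _ h₁ h₂ h₃ =>
    -- As `A - a` is even and positive, column `a + 2` is on the board.
    by_cases hA : a + 2 < A
    · exact .row_one (by omega) (.all_1k1 (by omega))
    · exact .row_two A (by omega) (.top_0k1 (by omega))
  | row_three _ h₁ h₂ h₃ =>
    by_cases hA : a + 2 < A
    · exact .row_two (a + 2) (by omega) (.even_012 (by omega))
    · exact .row_one (by omega) (.top_102 (by omega))
  | row_four _ h₁ h₂ h₃ => exact .row_one (by omega) (.odd_100 (by omega))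

theorem reply_even_012 (hm : Move A 4 a b c d a' b' c' d')
    (h : a < A ∧ (A - a) % 2 = 0 ∧ a = b ∧ b = c + 1 ∧ c = d + 2) :
    HasReply A 4 (FourRows A) a' b' c' d' := by
  cases hm with
  | row_one h₁ => exact .row_four (d + 1) (by omega) (.all_1k1 (by omega))
  | row_two _ h₁ h₂ h₃ => exact .row_four c (by omega) (.all_020 (by omega))
  | row_three _ h₁ h₂ h₃ => exact .row_four c (by omega) (.even_001 (by omega))
  | row_four _ h₁ h₂ h₃ =>
    by_cases hd : d' = d + 1
    · exact .row_one (by omega) (.all_1k1 (by omega))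
    · exact .row_two (a + 1) (by omega) (.all_020 (by omega))

theorem reply_even_101 (hm : Move A 4 a b c d a' b' c' d')
    (h : a < A ∧ (A - a) % 2 = 0 ∧ a = b + 1 ∧ b = c ∧ c = d + 1) :
    HasReply A 4 (FourRows A) a' b' c' d' := by
  cases hm with
  | row_one h₁ => exact .row_two a (by omega) (.all_1k1 (by omega))
  | row_two _ h₁ h₂ h₃ => exact .row_one (by omega) (.all_1k1 (by omega))
  | row_three _ h₁ h₂ h₃ => exact .row_three (a + 1) (by omega) (.odd_003 (by omega))
  | row_four _ h₁ h₂ h₃ => exact .row_three a (by omega) (.even_001 (by omega))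

/-- Away from the last column, single steps in rows two and four answer each other and shift the
pattern by one column; single steps in rows one and three answer each other and lead to `all_1k1`.
-/
theorem reply_all_020 (hm : Move A 4 a b c d a' b' c' d')
    (h : a < A ∧ a = b ∧ b = c + 2 ∧ c = d) : HasReply A 4 (FourRows A) a' b' c' d' := by
  cases hm with
  | row_one h₁ =>
    by_cases hA : a + 1 < A
    · exact .row_three (c + 1) (by omega) (.all_1k1 (by omega))
    · exact .row_three b (by omega) (.top_102 (by omega))
  | row_two _ h₁ h₂ h₃ =>
    by_cases hA : a + 1 < A
    -- From row lengths 3, 3, 0, 0 row four cannot be entered, so parity selects a reply in row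
    -- three.
    · by_cases hd : 1 ≤ d
      · exact .row_four (d + 1) (by omega) (.all_020 (by omega))
      · by_cases hp : (A - a) % 2 = 0
        · exact .row_three 3 (by omega) (.odd_003 (by omega))
        · exact .row_three 2 (by omega) (.even_012 (by omega))
    · exact .row_three (c + 1) (by omega) (.top_0k1 (by omega))
  | row_three _ h₁ h₂ h₃ =>
    by_cases hA : a + 1 < A
    · by_cases hc : c' = c + 1
      · exact .row_one (by omega) (.all_1k1 (by omega))
      · by_cases hp : (A - a) % 2 = 0
        · exact .row_three (a + 1) (by omega) (.odd_003 (by omega))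
        · exact .row_two (a + 1) (by omega) (.even_012 (by omega))
    · by_cases hc : c' = c + 1
      · exact .row_two A (by omega) (.top_0k1 (by omega))
      · exact .row_one (by omega) (.top_102 (by omega))
  | row_four _ h₁ h₂ h₃ =>
    by_cases hA : a + 1 < A
    · exact .row_two (a + 1) (by omega) (.all_020 (by omega))
    · exact .row_one (by omega) (.top_110 (by omega))

/-- Rows one and two, and rows three and four, form two staircases; a move in one is answered in the
same one until the lower staircase catches up with the upper or the last column is reached. -/
theorem reply_all_1k1 (hm : Move A 4 a b c d a' b' c' d')
    (h : a < A ∧ a = b + 1 ∧ c < b ∧ c = d + 1) : HasReply A 4 (FourRows A) a' b' c' d' := by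
  cases hm with
  | row_one h₁ =>
    by_cases hA : a + 1 < A
    · exact .row_two a (by omega) (.all_1k1 (by omega))
    · exact .row_two A (by omega) (.top_0k1 (by omega))
  | row_two _ h₁ h₂ h₃ =>
    by_cases hA : a + 1 < A
    · exact .row_one (by omega) (.all_1k1 (by omega))
    · exact .row_two A (by omega) (.top_0k1 (by omega))
  | row_three _ h₁ h₂ h₃ =>
    by_cases hb : c' < b
    · exact .row_four (c' - 1) (by omega) (.all_1k1 (by omega))
    -- Row three has caught up with row two; row four is then set one short of it or level with it,
    -- according to parity.
    · by_cases hp : (A - a) % 2 = 0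
      · exact .row_four (b - 1) (by omega) (.even_101 (by omega))
      · exact .row_four b (by omega) (.odd_100 (by omega))
  | row_four _ h₁ h₂ h₃ =>
    by_cases hb : c + 1 < b
    · exact .row_three (c + 1) (by omega) (.all_1k1 (by omega))
    · exact .row_two a (by omega) (.all_020 (by omega))

theorem hasReply (hA : 4 ≤ A) (h : FourRows A a b c d) (hd : d < A)
    (hm : Move A 4 a b c d a' b' c' d') : HasReply A 4 (FourRows A) a' b' c' d' := by
  cases h with
  | full h => omega
  | start h => exact reply_start hA hm h
  | top_0k1 h => exact reply_top_0k1 hm h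
  | top_102 h => exact reply_top_102 hm h
  | top_110 h => exact reply_top_110 hA hm h
  | odd_003 h => exact reply_odd_003 hm h
  | odd_100 h => exact reply_odd_100 hA hm h
  | even_001 h => exact reply_even_001 hm h
  | even_012 h => exact reply_even_012 hm h
  | even_101 h => exact reply_even_101 hm h
  | all_020 h => exact reply_all_020 hm h
  | all_1k1 h => exact reply_all_1k1 hm h

end FourRows

theorem board_four_rows {A : ℕ} (hA : 4 ≤ A) : HasWinningStrategy (boardGame A 4) .first := by
  refine board_first_wins_of_closed (by omega) (by omega) (by omega) (FourRows A)
    (fun h => h.isRegion hA) (.start (by omega)) fun {a b c d} h => ?_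
  refine (le_or_gt A d).imp_right fun hd => ?_
  exact fun hm => ⟨h.not_full_of_move hA hd hm, h.hasReply hA hd hm⟩

end ErdosSzekeres
theorem mainTheorem5 :
    -- the achievement game reduces to the avoidance game with one row and one column less
    (∀ a b : ℕ, 2 ≤ a → 2 ≤ b → ∀ p : ErdosSzekeres.Player,
      (∀ σ : List ℕ → ℕ,
        ErdosSzekeres.IsWinningStrategy (ErdosSzekeres.esGame .achievement a b) p σ →
        ErdosSzekeres.IsWinningStrategy (ErdosSzekeres.esGame .avoidance (a - 1) (b - 1)) p σ) ∧
      (∀ σ : List ℕ → ℕ,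
        ErdosSzekeres.IsWinningStrategy (ErdosSzekeres.esGame .avoidance (a - 1) (b - 1)) p σ →
        ∃ τ : List ℕ → ℕ,
          ErdosSzekeres.IsWinningStrategy (ErdosSzekeres.esGame .achievement a b) p τ ∧
          ∀ π : List ℕ, ¬ ErdosSzekeres.ContainsI (a - 1) π →
            ¬ ErdosSzekeres.ContainsJ (b - 1) π → τ π = σ π) ∧
      (ErdosSzekeres.HasWinningStrategy (ErdosSzekeres.esGame .achievement a b) p ↔
        ErdosSzekeres.HasWinningStrategy (ErdosSzekeres.esGame .avoidance (a - 1) (b - 1)) p) ∧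
      (ErdosSzekeres.HasWinningStrategy (ErdosSzekeres.esGame .achievement a b) p ↔
        ErdosSzekeres.HasWinningStrategy (ErdosSzekeres.boardGame (a - 2) (b - 2)) p)) ∧
    -- player 1 wins for `4 ≤ b ≤ 6`
    (∀ a b : ℕ, b ≤ a → 4 ≤ b → b ≤ 6 →
      ErdosSzekeres.HasWinningStrategy (ErdosSzekeres.esGame .achievement a b) .first) ∧
    -- the parity of `a` decides for `b = 3`
    (∀ a : ℕ, 3 ≤ a →
      (ErdosSzekeres.HasWinningStrategy (ErdosSzekeres.esGame .achievement a 3) .first ↔ Odd a) ∧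
      (ErdosSzekeres.HasWinningStrategy (ErdosSzekeres.esGame .achievement a 3) .second ↔
        Even a)) ∧
    -- player 2 wins for `b = 2`, by answering the permutation `1` with `21`
    (∀ a : ℕ, 2 ≤ a →
      ErdosSzekeres.HasWinningStrategy (ErdosSzekeres.esGame .achievement a 2) .second ∧
      ∀ σ : List ℕ → ℕ, σ [1] = 1 →
        ErdosSzekeres.IsWinningStrategy (ErdosSzekeres.esGame .achievement a 2) .second σ) := by
  refine ⟨fun a b ha hb p => ?_, fun a b hab hb hb' => ?_, fun a ha => ?_, fun a ha => ?_⟩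
  · obtain ⟨A, rfl⟩ : ∃ A, a = A + 2 := ⟨a - 2, by omega⟩
    obtain ⟨B, rfl⟩ : ∃ B, b = B + 2 := ⟨b - 2, by omega⟩
    obtain ⟨h₁, h₂⟩ := ErdosSzekeres.achievement_reduction (a := A + 1) (b := B + 1)
      (by omega) (by omega) p
    exact ⟨h₁, h₂, ErdosSzekeres.achievement_iff_avoidance (by omega) (by omega) p,
      ErdosSzekeres.achievement_iff_board A B p⟩
  · obtain ⟨A, rfl⟩ : ∃ A, a = A + 2 := ⟨a - 2, by omega⟩
    obtain rfl | rfl | rfl : b = 2 + 2 ∨ b = 3 + 2 ∨ b = 4 + 2 := by omega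
    · exact (ErdosSzekeres.achievement_iff_board A 2 _).2
        (ErdosSzekeres.board_two_rows (by omega))
    · exact (ErdosSzekeres.achievement_iff_board A 3 _).2
        (ErdosSzekeres.board_three_rows (by omega))
    · exact (ErdosSzekeres.achievement_iff_board A 4 _).2
        (ErdosSzekeres.board_four_rows (by omega))
  · obtain ⟨A, rfl⟩ : ∃ A, a = A + 2 := ⟨a - 2, by omega⟩
    have hodd : Odd (A + 2) ↔ Odd A := by simp [Nat.odd_add, parity_simps]
    have heven : Even (A + 2) ↔ Even A := by simp [parity_simps]
    rw [ErdosSzekeres.achievement_iff_board A 1, ErdosSzekeres.achievement_iff_board A 1, hodd,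
      heven]
    refine ⟨⟨fun h => ?_, ErdosSzekeres.board_one_row_first⟩,
      ⟨fun h => ?_, ErdosSzekeres.board_one_row_second⟩⟩
    -- In the other parity class the opponent has a winning strategy, and both players cannot have
    -- one.
    · by_contra hA
      rw [Nat.not_odd_iff_even] at hA
      cases h.player_unique (ErdosSzekeres.board_one_row_second hA)
    · by_contra hA
      rw [Nat.not_even_iff_odd] at hA
      cases h.player_unique (ErdosSzekeres.board_one_row_first hA)
  · exact ⟨⟨fun _ => 1, ErdosSzekeres.isWinningStrategy_achievement_two ha rfl⟩,
      fun _ => ErdosSzekeres.isWinningStrategy_achievement_two ha⟩
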